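/- Fix $r$ blocks of sizes $m_1,\dots,m_r\ge 1$, $n=m_1+\dots+m_r$, and write indices as $i(\alpha)$ with $1\le\alpha\le r$, $1\le i\le m_\alpha$. On an open set $U\subseteq\mathbb R^n$ with coordinates $u^{i(\alpha)}$, consider the product on vector fields with structure constants $c^{i(\alpha)}_{j(\beta)k(\gamma)}=\delta^\alpha_\beta\delta^\alpha_\gamma\delta^i_{j+k-1}$ and its unit $e$, $e^{i(\alpha)}=\delta^i_1$ (canonical, or David–Hertling, coordinates of a regular F-manifold). Repeated Latin indices are summed in the formulas (i.e. in the definitions and in system (A)). Let $X$ be a smooth vector field on $U$ with $X^{1(\alpha)}\ne X^{1(\beta)}$ everywhere for $\alpha\neq\beta$ and $X^{2(\alpha)}\neq 0$ everywhere for each $\alpha$ with $m_\alpha\ge2$. Let $\nabla$, with Christoffel symbols $\Gamma^i_{jk}$, be the torsionless connection characterised by $\nabla e=0$ and $d_\nabla(X\circ)=0$, where $(d_\nabla V)^i_{jk}=\nabla_jV^i_k-\nabla_kV^i_j$ and $X\circ$ is the tensor field $V^i_j=c^i_{js}X^s$. Assume that the system $u_t=X\circ u_x$ is of Darboux–Tsarev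 type: the Riemann tensor of $\nabla$ satisfies $$R^s_{lmi}c^j_{ks}+R^s_{lik}c^j_{ms}+R^s_{lkm}c^j_{is}=0$$ for all indices, and each $X^{i(\alpha)}$ depends (locally) only on the coordinates $u^{j(\sigma)}$ with $j\le i$, $\sigma\in\{1,\dots,r\}$. Then, for every differentiable one-form $\theta=\sum\theta_{i(\alpha)}\,du^{i(\alpha)}$ on $U$, the system (for the metric $g_{ij}=c^s_{ij}\theta_s$) $$c^q_{hj}\partial_i\theta_q+c^q_{ih}\partial_j\theta_q-c^s_{ij}\partial_s\theta_h=2c^q_{hs}\Gamma^s_{ij}\theta_q+c^s_{ij}c^q_{hs}e^t\partial_t\theta_q\qquad\text{for all } h,i,j\tag{A}$$ holds on $U$ if and only if all of the following equations hold on $U$, for all $\alpha,\beta\in\{1,\dots,r\}$: 1. $\partial_{j(\beta)}\theta_{i(\alpha)}=0$ for $1\le i\le m_\alpha$, $1\le j\le m_\beta$ with $i+j\ge m_\alpha+2$ if $\beta\ne\alpha$, and with $i+j\ge m_\alpha+3$ if $\beta=\alpha$; 2. $\displaystyle\partial_{2(\alpha)}\theta_{m_\alpha(\alpha)}=\frac{2}{m_\alpha}\Big(\sum_{k=2}^{m_\alpha}\Gamma^{k(\alpha)}_{2(\alpha)k(\alpha)}\Big)\theta_{m_\alpha(\alpha)}$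 if $m_\alpha\ge2$; 3. for $1\le i\le m_\alpha-1$, $3\le j\le m_\alpha$, $j\le m_\alpha-i+2$, $$\partial_{j(\alpha)}\theta_{i(\alpha)}=\partial_{(j-1)(\alpha)}\theta_{(i+1)(\alpha)}+\partial_{2(\alpha)}\theta_{(i+j-2)(\alpha)}-\partial_{1(\alpha)}\theta_{(i+j-1)(\alpha)}+2\sum_{s=j-1}^{m_\alpha-i+1}\Big(\Gamma^{(s-j+1)(\alpha)}_{1(\alpha)1(\alpha)}-\Gamma^{s(\alpha)}_{2(\alpha)(j-1)(\alpha)}\Big)\theta_{(i+s-1)(\alpha)};$$ 4. for $\alpha\ne\beta$, $1\le i\le m_\alpha$, $1\le j\le m_\beta$, $j\le m_\alpha-i+1$, $$\partial_{j(\beta)}\theta_{i(\alpha)}=2\sum_{s=j}^{m_\alpha-i+1}\Gamma^{s(\alpha)}_{j(\beta)1(\alpha)}\,\theta_{(s+i-1)(\alpha)}.$$ Here a component whose position in the block $\alpha$ lies outside $\{1,\dots,m_\alpha\}$ (namely $\theta_{(m_\alpha+1)(\alpha)}$ and $\Gamma^{0(\alpha)}_{1(\alpha)1(\alpha)}$ in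 3.) is read as $0$. -/

import Mathlib

open scoped ContDiff Topology

noncomputable section

namespace DarbouxTsarev

/-! ### Double indices and canonical coordinates

There are `r` blocks, of sizes `m α`. A double index `i(α)` is an element `⟨α, i - 1⟩` of
`Idx m`: mathematical positions start at `1`. A point of the coordinate space is the tuple of
its canonical coordinates `u^{i(α)}`. -/

/-- The set of double indices `i(α)`. -/
abbrev Idx {r : ℕ} (m : Fin r → ℕ) : Type := (α : Fin r) × Fin (m α)

/-- The coordinate space `ℝⁿ`, `n = m₁ + ⋯ + m_r`. -/
abbrev Pt {r : ℕ} (m : Fin r → ℕ) : Type := Idx m → ℝ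

variable {r : ℕ} {m : Fin r → ℕ}

/-- The position `i ∈ {1, …, m_α}` of the double index `i(α)`. -/
def pos (a : Idx m) : ℕ := (a.2 : ℕ) + 1

/-- `comp f α i` is the component `f_{i(α)}`, for `i ∈ {1, …, m_α}`; components whose position
lies outside this range are `0`. -/
def comp (f : Idx m → ℝ) (α : Fin r) (i : ℕ) : ℝ :=
  if h : 1 ≤ i ∧ i ≤ m α then f ⟨α, ⟨i - 1, by omega⟩⟩ else 0

/-- The partial derivative `∂_a f` at `u`. -/
def pd (a : Idx m) (f : Pt m → ℝ) (u : Pt m) : ℝ := fderiv ℝ f u (Pi.single a 1)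

/-- The structure constants `c^a_{bd}` of the product in canonical coordinates:
`c^{i(α)}_{j(β)k(γ)} = 1` if `α = β = γ` and `i = j + k - 1`, and `0` otherwise. -/
def prodC (a b d : Idx m) : ℝ :=
  if a.1 = b.1 ∧ a.1 = d.1 ∧ pos a + 1 = pos b + pos d then 1 else 0

/-- The unit vector field `e^{i(α)} = δ^i_1`. -/
def unitE (a : Idx m) : ℝ := if pos a = 1 then 1 else 0

/-! ### Connections

The Christoffel symbol `Γ^a_{bd}` at `u` is `Γ u a b d`. -/

/-- `∇_b Y^a` for a vector field `Y`. -/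
def covVec (Γ : Pt m → Idx m → Idx m → Idx m → ℝ) (Y : Pt m → Idx m → ℝ)
    (u : Pt m) (b a : Idx m) : ℝ :=
  pd b (fun v => Y v a) u + ∑ s, Γ u a b s * Y u s

/-- `∇_j V^i_k` for a `(1,1)`-tensor field `V`, with `V u i k = V^i_k`. -/
def covEnd (Γ : Pt m → Idx m → Idx m → Idx m → ℝ) (V : Pt m → Idx m → Idx m → ℝ)
    (u : Pt m) (j i k : Idx m) : ℝ :=
  pd j (fun v => V v i k) u + ∑ s, Γ u i j s * V u s k - ∑ s, Γ u s j k * V u i s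

/-- `(d_∇ V)^i_{jk} = ∇_j V^i_k - ∇_k V^i_j`. -/
def extCov (Γ : Pt m → Idx m → Idx m → Idx m → ℝ) (V : Pt m → Idx m → Idx m → ℝ)
    (u : Pt m) (i j k : Idx m) : ℝ :=
  covEnd Γ V u j i k - covEnd Γ V u k i j

/-- The components `R^k_{lij}` of the Riemann tensor: `R(∂_i, ∂_j) ∂_l = R^k_{lij} ∂_k`. -/
def riemann (Γ : Pt m → Idx m → Idx m → Idx m → ℝ) (u : Pt m) (k l i j : Idx m) : ℝ :=
  pd i (fun v => Γ v k j l) u - pd j (fun v => Γ v k i l) u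
    + ∑ s, Γ u k i s * Γ u s j l - ∑ s, Γ u k j s * Γ u s i l

/-- The operator `X∘`, `V^i_j = c^i_{js} X^s`. -/
def mulOp (X : Pt m → Idx m → ℝ) (u : Pt m) (i j : Idx m) : ℝ := ∑ s, prodC i j s * X u s

/-- `Γ` is the torsionless connection on `U` associated with `X`, characterised by `∇e = 0` and
`d_∇ (X∘) = 0`. -/
structure IsAssociatedConnection (U : Set (Pt m)) (X : Pt m → Idx m → ℝ)
    (Γ : Pt m → Idx m → Idx m → Idx m → ℝ) : Prop where
  smooth : ∀ a b d, ContDiffOn ℝ ∞ (fun u => Γ u a b d) U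
  torsionless : ∀ u ∈ U, ∀ a b d, Γ u a b d = Γ u a d b
  flat_unit : ∀ u ∈ U, ∀ a b, covVec Γ (fun _ => unitE) u b a = 0
  d_nabla : ∀ u ∈ U, ∀ i j k, extCov Γ (mulOp X) u i j k = 0

/-- On `U`, the function `f` depends (locally) only on the coordinates `u^{j(σ)}` with `j ≤ i`. -/
def DependsOnlyUpTo (U : Set (Pt m)) (i : ℕ) (f : Pt m → ℝ) : Prop :=
  ∀ p ∈ U, ∃ W ∈ 𝓝 p, ∀ u ∈ W ∩ U, ∀ v ∈ W ∩ U,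
    (∀ b : Idx m, pos b ≤ i → u b = v b) → f u = f v

/-- The system `u_t = X ∘ u_x` is of Darboux–Tsarev type on `U`, and `Γ` is its associated
connection. The condition on `X^{2(α)}` concerns the blocks of size at least `2`. -/
structure IsDarbouxTsarev (U : Set (Pt m)) (X : Pt m → Idx m → ℝ)
    (Γ : Pt m → Idx m → Idx m → Idx m → ℝ) : Prop where
  smooth : ∀ a, ContDiffOn ℝ ∞ (fun u => X u a) U
  distinct : ∀ u ∈ U, ∀ α β, α ≠ β → comp (X u) α 1 ≠ comp (X u) β 1
  nonzero : ∀ u ∈ U, ∀ α, 2 ≤ m α → comp (X u) α 2 ≠ 0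
  connection : IsAssociatedConnection U X Γ
  curvature : ∀ u ∈ U, ∀ j k l i q,
    ∑ s, (riemann Γ u s l q i * prodC j k s + riemann Γ u s l i k * prodC j q s
      + riemann Γ u s l k q * prodC j i s) = 0
  depends : ∀ a, DependsOnlyUpTo U (pos a) (fun u => X u a)

/-! ### The two systems

The unknowns are the components `θ_a` of a one-form; the metric is `g_{ab} = c^s_{ab} θ_s`. -/

/-- The system
`c^r_{hj} ∂_i θ_r + c^r_{ih} ∂_j θ_r - c^s_{ij} ∂_s θ_h
  = 2 c^r_{hs} Γ^s_{ij} θ_r + c^s_{ij} c^r_{hs} e^t ∂_t θ_r`. -/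
def MetricSystem (U : Set (Pt m)) (Γ : Pt m → Idx m → Idx m → Idx m → ℝ)
    (θ : Pt m → Idx m → ℝ) : Prop :=
  ∀ u ∈ U, ∀ h i j : Idx m,
    ∑ q, prodC q h j * pd i (fun v => θ v q) u + ∑ q, prodC q i h * pd j (fun v => θ v q) u
        - ∑ s, prodC s i j * pd s (fun v => θ v h) u
      = 2 * ∑ q, ∑ s, prodC q h s * Γ u s i j * θ u q
        + ∑ s, ∑ q, ∑ t, prodC s i j * prodC q h s * unitE t * pd t (fun v => θ v q) u

/-- `Γ^{i(α)}_{j(β)k(γ)}` at `u`. -/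
def chr (Γ : Pt m → Idx m → Idx m → Idx m → ℝ) (u : Pt m)
    (i : ℕ) (α : Fin r) (j : ℕ) (β : Fin r) (k : ℕ) (γ : Fin r) : ℝ :=
  comp (fun a => comp (fun b => comp (fun d => Γ u a b d) γ k) β j) α i

/-- `∂_{j(β)} θ_{i(α)}` at `u`. -/
def dTheta (θ : Pt m → Idx m → ℝ) (u : Pt m) (j : ℕ) (β : Fin r) (i : ℕ) (α : Fin r) : ℝ :=
  comp (fun b => comp (fun a => pd b (fun v => θ v a) u) α i) β j

/-- The explicit system, in double-index notation. -/
structure ExplicitSystem (U : Set (Pt m)) (Γ : Pt m → Idx m → Idx m → Idx m → ℝ)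
    (θ : Pt m → Idx m → ℝ) : Prop where
  zeros : ∀ u ∈ U, ∀ α β : Fin r, ∀ i j : ℕ, 1 ≤ i → i ≤ m α → 1 ≤ j → j ≤ m β →
    m α + (if β = α then 3 else 2) ≤ i + j →
      dTheta θ u j β i α = 0
  top : ∀ u ∈ U, ∀ α : Fin r, 2 ≤ m α →
    dTheta θ u 2 α (m α) α
      = 2 / (m α : ℝ) * (∑ k ∈ Finset.Icc 2 (m α), chr Γ u k α 2 α k α) * comp (θ u) α (m α)
  sameBlock : ∀ u ∈ U, ∀ α : Fin r, ∀ i j : ℕ, 1 ≤ i → i + 1 ≤ m α → 3 ≤ j → j ≤ m α →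
    i + j ≤ m α + 2 →
      dTheta θ u j α i α
        = dTheta θ u (j - 1) α (i + 1) α + dTheta θ u 2 α (i + j - 2) α
          - dTheta θ u 1 α (i + j - 1) α
          + 2 * ∑ s ∈ Finset.Icc (j - 1) (m α + 1 - i),
              (chr Γ u (s + 1 - j) α 1 α 1 α - chr Γ u s α 2 α (j - 1) α)
                * comp (θ u) α (i + s - 1)
  diffBlock : ∀ u ∈ U, ∀ α β : Fin r, α ≠ β → ∀ i j : ℕ,
    1 ≤ i → i ≤ m α → 1 ≤ j → j ≤ m β → i + j ≤ m α + 1 →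
      dTheta θ u j β i α
        = 2 * ∑ s ∈ Finset.Icc j (m α + 1 - i), chr Γ u s α j β 1 α * comp (θ u) α (s + i - 1)

end DarbouxTsarev

end

namespace DarbouxTsarev

/-! Within a block the product is multiplication of truncated polynomials, so `X∘` acts on each
block by a triangular Toeplitz matrix. Written in blocks, `d_∇ (X∘) = 0` becomes a family of
Sylvester equations for the Christoffel symbols with derivatives of `X` as right-hand sides
(`dnabla_eq`).

For distinct blocks the diagonal entries `X^{1(α)}` differ, so these equations have unique
solutions. Hence symbols with three distinct blocks vanish, and `Γ^{i(α)}_{j(β)k(α)}` depends on `i`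
and `k` only through `i + 1 - k`. When both lower indices lie in `β ≠ α`, `X^{2(β)} ≠ 0` makes the
symbol depend only on `j + k`, and `∇e = 0` identifies it with minus a mixed symbol. The triangular
dependence of `X` removes derivative terms and gives the vanishing of symbols with large lower
indices.

The metric system therefore splits into equations between two blocks, which prescribe `∂_{j(β)}
θ_{i(α)}`, and equations inside one block. In the latter, `e^t ∂_t θ` is rewritten by the former, so
that only the deviation `defect` of `Γ^i_{jk}` from `Γ^{i-j-k+2}_{11}` remains. Eliminating the
derivatives of `X` shows that this deviation satisfies a cocycle identity (`defect_cocycle`), so the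
equations with one index equal to `2` imply all others (`block_system_iff`). Telescoping these along
the antidiagonal of total degree `m α + 2` yields the formula for `∂_{2(α)} θ_{m_α(α)}`. -/

/-! ### Sylvester, Hankel and cochain lemmas for truncated polynomials. -/

theorem sum_range_eq_head {n : ℕ} (hn : 1 ≤ n) (f : ℕ → ℝ) (hf : ∀ l, 1 ≤ l → f l = 0) :
    ∑ l ∈ Finset.range n, f l = f 0 :=
  Finset.sum_eq_single 0 (fun l _ hl => hf l (Nat.one_le_iff_ne_zero.2 hl))
    (fun h => absurd (Finset.mem_range.2 hn) h)

theorem sum_range_eq_second {n : ℕ} (hn : 2 ≤ n) (f : ℕ → ℝ) (h0 : f 0 = 0)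
    (hf : ∀ l, 2 ≤ l → f l = 0) : ∑ l ∈ Finset.range n, f l = f 1 :=
  Finset.sum_eq_single 1
    (fun l _ hl => by
      rcases Nat.eq_zero_or_pos l with rfl | h
      · exact h0
      · exact hf l (by omega))
    (fun h => absurd (Finset.mem_range.2 hn) h)

/-- A Sylvester equation for a bilinear pairing of two triangular Toeplitz operators with distinct
diagonal entries has only the trivial solution. -/
theorem sylvester_unique {p q : ℕ} (hp : 1 ≤ p) (hq : 1 ≤ q) {a b : ℕ → ℝ} (hab : a 0 ≠ b 0)
    {S : ℕ → ℕ → Prop} (hS : ∀ j k l, S j k → S (j + l) k ∧ S j (k + l))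
    {N : ℕ → ℕ → ℝ} (hj : ∀ j k, p < j → N j k = 0) (hk : ∀ j k, q < k → N j k = 0)
    (h : ∀ j k, 1 ≤ j → 1 ≤ k → S j k → ∑ l ∈ Finset.range q, a l * N j (k + l)
      = ∑ l ∈ Finset.range p, b l * N (j + l) k) :
    ∀ j k, 1 ≤ j → 1 ≤ k → S j k → N j k = 0 := by
  -- Descending induction on `j + k`: the terms with `l ≥ 1` have larger total degree and vanish,
  -- which leaves `(a 0 - b 0) * N j k = 0`.
  suffices H : ∀ n j k, p + q < j + k + n → 1 ≤ j → 1 ≤ k → S j k → N j k = 0 from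
    fun j k => H (p + q + 1) j k (by omega)
  intro n
  induction n with
  | zero =>
    intro j k hn _ _ _
    by_cases hjp : p < j
    · exact hj j k hjp
    · exact hk j k (by omega)
  | succ n ih =>
    intro j k hn h1 h2 hs
    have e := h j k h1 h2 hs
    rw [sum_range_eq_head hq _ fun l hl => by
        rw [ih j (k + l) (by omega) h1 (by omega) (hS j k l hs).2, mul_zero],
      sum_range_eq_head hp _ fun l hl => by
        rw [ih (j + l) k (by omega) (by omega) h2 (hS j k l hs).1, mul_zero]] at e
    have e2 : (a 0 - b 0) * N j k = 0 := by
      simp only [add_zero] at e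
      linarith
    exact (mul_eq_zero.1 e2).resolve_left (sub_ne_zero.2 hab)

/-- If a symmetric form satisfies `N(a, x ∘ b) = N(x ∘ a, b)` on high degrees, for a generator `x`
of the algebra of truncated polynomials, then it depends only on the total degree there. -/
theorem hankel_of_generator {p n₀ : ℕ} {x : ℕ → ℝ} (hx : 2 ≤ p → x 1 ≠ 0)
    {N : ℕ → ℕ → ℝ} (hN : ∀ j k, N j k = N k j) (hz : ∀ j k, p < k → N j k = 0)
    (h : ∀ j k, 1 ≤ j → 1 ≤ k → n₀ ≤ j + k → ∑ l ∈ Finset.range p, x l * N j (k + l)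
      = ∑ l ∈ Finset.range p, x l * N k (j + l)) :
    ∀ j k, 1 ≤ j → 1 ≤ k → n₀ ≤ j + k → N j (k + 1) = N (j + 1) k := by
  suffices H : ∀ n j k, 2 * p < j + k + n → 1 ≤ j → 1 ≤ k → n₀ ≤ j + k →
      N j (k + 1) = N (j + 1) k from
    fun j k => H (2 * p + 1) j k (by omega)
  intro n
  induction n with
  | zero =>
    intro j k hn _ _ _
    by_cases hkp : p < k
    · rw [hz j (k + 1) (by omega), hz (j + 1) k hkp]
    · rw [hN j, hN (j + 1), hz (k + 1) j (by omega), hz k (j + 1) (by omega)]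
  | succ n ih =>
    intro j k hn hj hk hs
    have chain : ∀ l j' k', j + k < j' + k' → 1 ≤ j' → 1 ≤ k' → N j' (k' + l) = N (j' + l) k' := by
      intro l
      induction l with
      | zero => intros; rfl
      | succ l ihl =>
        intro j' k' h1 h2 h3
        rw [← add_assoc, ih j' (k' + l) (by omega) h2 (by omega) (by omega),
          ihl (j' + 1) k' (by omega) (by omega) h3]
        congr 1
        omega
    rcases Nat.lt_or_ge p 2 with hp | hp
    · rw [hz j (k + 1) (by omega), hN, hz k (j + 1) (by omega)]
    · have e : ∑ l ∈ Finset.range p, x l * (N j (k + l) - N k (j + l)) = 0 := by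
        simp only [mul_sub, Finset.sum_sub_distrib]
        rw [h j k hj hk hs, sub_self]
      -- The term `l = 0` cancels by symmetry. For `l ≥ 2` the total degree is higher, where `N` is
      -- already known to depend only on it. Only the coefficient `x 1` survives.
      rw [sum_range_eq_second hp _ (by rw [add_zero, add_zero, hN j k, sub_self, mul_zero])
        fun l hl => ?_] at e
      · have := (mul_eq_zero.1 e).resolve_left (hx hp)
        rw [hN (j + 1) k]
        linarith
      · obtain ⟨l, rfl⟩ : ∃ l', l = l' + 1 := ⟨l - 1, by omega⟩
        have := chain l j (k + 1) (by omega) hj (by omega)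
        rw [show k + (l + 1) = k + 1 + l by omega, this, hN (j + l),
          ← ih k (j + l) (by omega) hk (by omega) (by omega)]
        rw [add_assoc, sub_self, mul_zero]

theorem hankel_eq {n₀ : ℕ} {N : ℕ → ℕ → ℝ}
    (h : ∀ j k, 1 ≤ j → 1 ≤ k → n₀ ≤ j + k → N j (k + 1) = N (j + 1) k) :
    ∀ k j, 1 ≤ j → 1 ≤ k → n₀ + 1 ≤ j + k → N k j = N 1 (k + j - 1) := by
  intro k
  induction k with
  | zero => intro j _ h; omega
  | succ k ih =>
    intro j hj _ hn
    rcases Nat.eq_zero_or_pos k with rfl | hk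
    · congr 1
      omega
    · rw [← h k j hk hj (by omega), ih (j + 1) (by omega) hk (by omega)]
      congr 1
      omega

/-- A symmetric two-cochain on degrees which is closed against the degree of `x` is a
coboundary. -/
theorem coboundary_of_closed {L : ℕ} {H : ℕ → ℕ → ℝ} (h1 : ∀ p, 1 ≤ p → p ≤ L → H p 1 = 0)
    (h : ∀ p q, 1 ≤ p → 1 ≤ q → p + q ≤ L → H p (q + 1) - H (p + 1) q = H p 2 - H q 2) :
    ∀ q p, 1 ≤ p → 1 ≤ q → p + q ≤ L + 1 →
      H p q = ∑ l ∈ Finset.Ico 1 (p + q - 1), H l 2 - ∑ l ∈ Finset.Ico 1 p, H l 2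
        - ∑ l ∈ Finset.Ico 1 q, H l 2 := by
  intro q
  induction q with
  | zero => intro p _ h; omega
  | succ q ih =>
    intro p hp _ hL
    rcases Nat.eq_zero_or_pos q with rfl | hq
    · rw [zero_add, h1 p hp (by omega)]
      simp
    · have e := ih (p + 1) (by omega) hq (by omega)
      have e2 := h p q hp hq (by omega)
      rw [Finset.sum_Ico_succ_top hp] at e
      rw [Finset.sum_Ico_succ_top hq]
      rw [show p + (q + 1) - 1 = p + 1 + q - 1 by omega]
      linarith

/-- Multiplication by a basis element moves a shift from the symbols to the one-form. Truncated
subtraction is harmless because `F 0 = 0`, and the terms pushed past the end vanish because `t`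
does. -/
theorem sum_shift {p : ℕ} {F t : ℕ → ℝ} (hF : F 0 = 0) (ht : ∀ n, p < n → t n = 0) (h : ℕ)
    (hh : 1 ≤ h) (d : ℕ) :
    ∑ s ∈ Finset.range (p + 1), F (s - d) * t (h + s - 1)
      = ∑ s ∈ Finset.range (p + 1), F s * t (h + d + s - 1) := by
  induction d generalizing h with
  | zero => rfl
  | succ d ih =>
    rw [show h + (d + 1) = h + 1 + d by omega, ← ih (h + 1) (by omega)]
    rw [Finset.sum_range_succ', Finset.sum_range_succ (fun s => F (s - d) * t (h + 1 + s - 1))]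
    rw [Nat.zero_sub, hF, ht (h + 1 + p - 1) (by omega)]
    simp only [zero_mul, mul_zero, add_zero]
    refine Finset.sum_congr rfl fun s _ => ?_
    rw [show s + 1 - (d + 1) = s - d by omega, show h + (s + 1) - 1 = h + 1 + s - 1 by omega]

/-! ### The defect of a single block and its cocycle identity. -/

/-- The deviation of a family of symbols `N^i_{jk}` from `N^{i-j-k+2}_{11}`. -/
def defect (N : ℕ → ℕ → ℕ → ℝ) (i j k : ℕ) : ℝ := N i j k - N (i + 2 - j - k) 1 1

section Defect

variable {p : ℕ} {N : ℕ → ℕ → ℕ → ℝ}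

theorem defect_symm (hN : ∀ i j k, N i j k = N i k j) (i j k : ℕ) :
    defect N i j k = defect N i k j := by
  rw [defect, defect, hN, show i + 2 - j - k = i + 2 - k - j by omega]

theorem defect_zero (h0 : ∀ j k, N 0 j k = 0) (j k : ℕ) (h : 2 ≤ j + k) :
    defect N 0 j k = 0 := by
  rw [defect, show 0 + 2 - j - k = 0 by omega, h0, h0, sub_zero]

theorem defect_one (h1 : ∀ i k, i ≤ p → 1 ≤ k → N i 1 k = N (i + 1 - k) 1 1) (i k : ℕ)
    (hi : i ≤ p) (hk : 1 ≤ k) : defect N i 1 k = 0 := by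
  rw [defect, h1 i k hi hk, show i + 2 - 1 - k = i + 1 - k by omega, sub_self]

theorem defect_low (h0 : ∀ j k, N 0 j k = 0)
    (hv : ∀ i j k, i ≤ p → 1 ≤ j → 1 ≤ k → i + 2 < j + k → N i j k = 0) (i j k : ℕ) (hi : i ≤ p)
    (hj : 1 ≤ j) (hk : 1 ≤ k) (h : i + 2 < j + k) : defect N i j k = 0 := by
  rw [defect, hv i j k hi hj hk h, show i + 2 - j - k = 0 by omega, h0, sub_zero]

/-- The equation relating the defects, obtained by eliminating the derivatives `D`. -/
theorem sum_defect_eq_zero {x : ℕ → ℝ} {D : ℕ → ℕ → ℝ}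
    (h1 : ∀ i k, i ≤ p → 1 ≤ k → N i 1 k = N (i + 1 - k) 1 1)
    (he : ∀ i j k, i ≤ p → 1 ≤ j → 1 ≤ k →
      D j (i + 1 - k) + ∑ l ∈ Finset.range p, x l * N i j (k + l)
        = D k (i + 1 - j) + ∑ l ∈ Finset.range p, x l * N i k (j + l))
    (i j k : ℕ) (hi : i ≤ p) (hj : 1 ≤ j) (hk : 1 ≤ k) :
    ∑ l ∈ Finset.range p, x l * (defect N i j (k + l) - defect N i k (j + l)
      + defect N (i + 1 - j) k (1 + l) - defect N (i + 1 - k) j (1 + l)) = 0 := by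
  -- Two further instances with lower index `1` express `D k (i + 1 - j)` and `D j (i + 1 - k)`
  -- through the same value of `D 1`, which then cancels.
  have e1 := he i j k hi hj hk
  have e2 := he (i + 1 - j) k 1 (by omega) hk le_rfl
  have e3 := he (i + 1 - k) j 1 (by omega) hj le_rfl
  have s1 : ∑ l ∈ Finset.range p, x l * N (i + 1 - j) 1 (k + l)
      = ∑ l ∈ Finset.range p, x l * N (i + 2 - j - (k + l)) 1 1 :=
    Finset.sum_congr rfl fun l _ => by
      rw [h1 _ _ (by omega) (by omega),
        show i + 1 - j + 1 - (k + l) = i + 2 - j - (k + l) by omega]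
  have s2 : ∑ l ∈ Finset.range p, x l * N (i + 1 - k) 1 (j + l)
      = ∑ l ∈ Finset.range p, x l * N (i + 2 - j - (k + l)) 1 1 :=
    Finset.sum_congr rfl fun l _ => by
      rw [h1 _ _ (by omega) (by omega),
        show i + 1 - k + 1 - (j + l) = i + 2 - j - (k + l) by omega]
  have s3 : ∑ l ∈ Finset.range p, x l * (defect N i j (k + l) - defect N i k (j + l)
      + defect N (i + 1 - j) k (1 + l) - defect N (i + 1 - k) j (1 + l))
      = ∑ l ∈ Finset.range p, (x l * N i j (k + l) - x l * N i k (j + l)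
      + x l * N (i + 1 - j) k (1 + l) - x l * N (i + 1 - k) j (1 + l)) :=
    Finset.sum_congr rfl fun l _ => by
      simp only [defect]
      rw [show i + 2 - k - (j + l) = i + 2 - j - (k + l) by omega,
        show i + 1 - j + 2 - k - (1 + l) = i + 2 - j - (k + l) by omega,
        show i + 1 - k + 2 - j - (1 + l) = i + 2 - j - (k + l) by omega]
      ring
  rw [s3]
  simp only [Finset.sum_add_distrib, Finset.sum_sub_distrib]
  rw [s1, show i + 1 - j + 1 - k = i + 1 - k + 1 - j by omega] at e2
  rw [s2] at e3
  rw [Nat.add_sub_cancel] at e2 e3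
  linarith

/-- The defects satisfy the cocycle identity against degree two. -/
theorem defect_cocycle {x : ℕ → ℝ} (hx : 2 ≤ p → x 1 ≠ 0) {D : ℕ → ℕ → ℝ}
    (hN : ∀ i j k, N i j k = N i k j) (h0 : ∀ j k, N 0 j k = 0)
    (h1 : ∀ i k, i ≤ p → 1 ≤ k → N i 1 k = N (i + 1 - k) 1 1)
    (hv : ∀ i j k, i ≤ p → 1 ≤ j → 1 ≤ k → i + 2 < j + k → N i j k = 0)
    (he : ∀ i j k, i ≤ p → 1 ≤ j → 1 ≤ k →
      D j (i + 1 - k) + ∑ l ∈ Finset.range p, x l * N i j (k + l)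
        = D k (i + 1 - j) + ∑ l ∈ Finset.range p, x l * N i k (j + l)) :
    ∀ i j k, i ≤ p → 1 ≤ j → 1 ≤ k →
      defect N i j (k + 1) - defect N i (j + 1) k
        = defect N (i + 1 - k) j 2 - defect N (i + 1 - j) k 2 := by
  -- Induction on the weight `i - j - k`, starting where every defect involved vanishes.
  suffices H : ∀ n i j k, i + 1 < j + k + n → i ≤ p → 1 ≤ j → 1 ≤ k →
      defect N i j (k + 1) - defect N i (j + 1) k
        = defect N (i + 1 - k) j 2 - defect N (i + 1 - j) k 2 from
    fun i j k hi => H (p + 2) i j k (by omega) hi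
  have low2 : ∀ i j k, i ≤ p → 1 ≤ j → 1 ≤ k → i + 1 < j + k → defect N (i + 1 - k) j 2 = 0 := by
    intro i j k hi hj hk h
    rcases Nat.lt_or_ge i k with hik | hik
    · rw [show i + 1 - k = 0 by omega]
      exact defect_zero h0 _ _ (by omega)
    · exact defect_low h0 hv _ _ _ (by omega) hj (by omega) (by omega)
  intro n
  induction n with
  | zero =>
    intro i j k hn hi hj hk
    rw [defect_low h0 hv i _ _ hi hj (by omega) (by omega),
      defect_low h0 hv i _ _ hi (by omega) hk (by omega), low2 i j k hi hj hk (by omega),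
      low2 i k j hi hk hj (by omega)]
  | succ n ih =>
    intro i j k hn hi hj hk
    rcases Nat.lt_or_ge (i + 1) (j + k + n) with hlt | hge
    · exact ih i j k hlt hi hj hk
    rcases Nat.lt_or_ge p 2 with hp | hp
    · obtain rfl : j = 1 := by omega
      obtain rfl : k = 1 := by omega
      rw [defect_symm hN i 1, sub_self, sub_self]
    have e := sum_defect_eq_zero h1 he i j k hi hj hk
    rw [sum_range_eq_second hp] at e
    · have e := (mul_eq_zero.1 e).resolve_left (hx hp)
      rw [defect_symm hN i (j + 1)]
      rw [show 1 + 1 = 2 from rfl] at e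
      linarith
    · rw [add_zero, add_zero, add_zero, defect_symm hN i j, defect_symm hN _ k 1,
        defect_symm hN _ j 1,
        defect_one h1 _ _ (by omega) hk, defect_one h1 _ _ (by omega) hj]
      ring
    · intro l hl
      rcases Nat.lt_or_ge (n + 1) l with hln | hln
      · rw [defect_low h0 hv i _ _ hi hj (by omega) (by omega),
          defect_low h0 hv i _ _ hi hk (by omega) (by omega),
          defect_low h0 hv _ _ _ (by omega) hk (by omega) (by omega),
          defect_low h0 hv _ _ _ (by omega) hj (by omega) (by omega)]
        ring
      -- The four defects of index `l` share the lower weight `t`. By induction they are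
      -- coboundaries `f (a + b - 1) - f a - f b` of one function `f`, and their alternating sum is
      -- zero.
      · obtain ⟨t, rfl⟩ : ∃ t, n = t + l - 1 := ⟨n + 1 - l, by omega⟩
        have c := coboundary_of_closed (L := p + 1 - t)
          (H := fun a b => defect N (t + a + b - 2) a b)
          (fun a ha hL => by
            show defect N _ _ _ = 0
            rw [defect_symm hN]
            exact defect_one h1 _ _ (by omega) ha)
          (fun a b ha hb hL => by
            have := ih (t + a + b - 1) a b (by omega) (by omega) ha hb
            rw [show t + a + b - 1 + 1 - b = t + a + 2 - 2 by omega,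
              show t + a + b - 1 + 1 - a = t + b + 2 - 2 by omega] at this
            show defect N (t + a + (b + 1) - 2) a (b + 1) - defect N (t + (a + 1) + b - 2) (a + 1) b
              = defect N (t + a + 2 - 2) a 2 - defect N (t + b + 2 - 2) b 2
            rw [← this, show t + a + (b + 1) - 2 = t + a + b - 1 by omega,
              show t + (a + 1) + b - 2 = t + a + b - 1 by omega])
        have c1 := c (k + l) j hj (by omega) (by omega)
        have c2 := c (j + l) k hk (by omega) (by omega)
        have c3 := c (1 + l) k hk (by omega) (by omega)
        have c4 := c (1 + l) j hj (by omega) (by omega)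
        beta_reduce at c1 c2 c3 c4
        rw [show t + j + (k + l) - 2 = i by omega] at c1
        rw [show t + k + (j + l) - 2 = i by omega,
          show k + (j + l) - 1 = j + (k + l) - 1 by omega] at c2
        rw [show t + k + (1 + l) - 2 = i + 1 - j by omega,
          show k + (1 + l) - 1 = k + l by omega] at c3
        rw [show t + j + (1 + l) - 2 = i + 1 - k by omega,
          show j + (1 + l) - 1 = j + l by omega] at c4
        rw [c1, c2, c3, c4]
        ring

end Defect

/-! ### Toeplitz solutions of the mixed-block equation. -/

/-- A form solving a Sylvester equation with triangular Toeplitz coefficients and a triangular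
Toeplitz right-hand side is itself triangular Toeplitz. -/
theorem toeplitz_of_sylvester {p q : ℕ} (hp : 1 ≤ p) (hq : 1 ≤ q) {a b : ℕ → ℝ}
    (hab : a 0 ≠ b 0) {M : ℕ → ℕ → ℕ → ℝ} {D : ℕ → ℕ → ℝ} (h0 : ∀ j k, M j 0 k = 0)
    (hj : ∀ j i k, q < j → M j i k = 0) (hk : ∀ j i k, p < k → M j i k = 0)
    (h : ∀ i j k, i ≤ p → 1 ≤ j → 1 ≤ k →
      D j (i + 1 - k) + ∑ l ∈ Finset.range p, a l * M j i (k + l)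
        = ∑ l ∈ Finset.range q, b l * M (j + l) i k) :
    ∀ i j k, i ≤ p → 1 ≤ j → 1 ≤ k → M j i k = M j (i + 1 - k) 1 := by
  -- The right-hand side depends on `i` and `k` only through `i + 1 - k`. The difference of `M`
  -- along this diagonal therefore solves the homogeneous Sylvester equation.
  have step : ∀ i, 1 ≤ i → i ≤ p → ∀ j k, 1 ≤ j → 1 ≤ k → True →
      M j i (k + 1) - M j (i - 1) k = 0 := by
    intro i hi1 hi
    refine sylvester_unique (p := q) (q := p) hq hp hab (fun _ _ _ _ => ⟨trivial, trivial⟩)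
      (fun j k hjq => by rw [hj _ _ _ hjq, hj _ _ _ hjq, sub_zero])
      (fun j k hkp => by rw [hk _ _ _ hkp, hk _ _ _ (by omega), sub_zero]) ?_
    intro j k hj1 hk1 _
    have e1 := h i j (k + 1) hi hj1 (by omega)
    have e2 := h (i - 1) j k (by omega) hj1 hk1
    rw [show i + 1 - (k + 1) = i - 1 + 1 - k by omega] at e1
    simp only [mul_sub, Finset.sum_sub_distrib]
    simp only [add_right_comm k 1] at e1
    linarith
  intro i j k hi hj1
  induction k generalizing i with
  | zero => intro h; omega
  | succ k ih =>
    intro _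
    rcases Nat.eq_zero_or_pos k with rfl | hk0
    · rw [zero_add, Nat.add_sub_cancel]
    · rcases Nat.eq_zero_or_pos i with rfl | hi0
      · rw [h0, show 0 + 1 - (k + 1) = 0 by omega, h0]
      · rw [sub_eq_zero.1 (step i hi0 hi j k hj1 hk0 trivial), ih (i - 1) (by omega) hk0]
        congr 1
        omega

/-! ### Calculus with double indices, extended by zero. -/

variable {r : ℕ} {m : Fin r → ℕ}

theorem comp_pos (f : Idx m → ℝ) (a : Idx m) : comp f a.1 (pos a) = f a := by
  have h : 1 ≤ pos a ∧ pos a ≤ m a.1 := ⟨Nat.le_add_left _ _, a.2.2⟩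
  rw [comp, dif_pos h]
  rfl

theorem comp_of_gt (f : Idx m → ℝ) {α : Fin r} {i : ℕ} (h : m α < i) : comp f α i = 0 :=
  dif_neg (by omega)

theorem comp_at_zero (f : Idx m → ℝ) (α : Fin r) : comp f α 0 = 0 :=
  dif_neg (by omega)

/-- The double index `i(α)` for `1 ≤ i ≤ m_α`. -/
def idx (α : Fin r) (i : ℕ) (h : 1 ≤ i ∧ i ≤ m α) : Idx m := ⟨α, ⟨i - 1, by omega⟩⟩

theorem pos_idx (α : Fin r) (i : ℕ) (h : 1 ≤ i ∧ i ≤ m α) : pos (idx α i h) = i :=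
  Nat.sub_add_cancel h.1

theorem comp_eq_idx (f : Idx m → ℝ) (α : Fin r) (i : ℕ) (h : 1 ≤ i ∧ i ≤ m α) :
    comp f α i = f (idx α i h) := dif_pos h

theorem pos_bounds (a : Idx m) : 1 ≤ pos a ∧ pos a ≤ m a.1 := ⟨Nat.le_add_left _ _, a.2.2⟩

theorem idx_ext {a b : Idx m} (h : a.1 = b.1) (h2 : pos a = pos b) : a = b := by
  obtain ⟨α, i⟩ := a
  obtain ⟨β, j⟩ := b
  obtain rfl : α = β := h
  simp only [pos] at h2
  obtain rfl : i = j := Fin.ext (by omega)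
  rfl

theorem sum_idx (f : Idx m → ℝ) :
    ∑ a, f a = ∑ α, ∑ l ∈ Finset.range (m α), comp f α (l + 1) := by
  rw [Fintype.sum_sigma]
  refine Finset.sum_congr rfl fun α _ => ?_
  rw [Finset.sum_range]
  exact Finset.sum_congr rfl fun l _ => (comp_pos f ⟨α, l⟩).symm

theorem sum_prodC_upper (F : Idx m → ℝ) (b d : Idx m) :
    ∑ q, prodC q b d * F q = if b.1 = d.1 then comp F b.1 (pos b + pos d - 1) else 0 := by
  have hb := pos_bounds b
  have hd := pos_bounds d
  split_ifs with h
  · by_cases hr : pos b + pos d - 1 ≤ m b.1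
    · have hr' : 1 ≤ pos b + pos d - 1 ∧ pos b + pos d - 1 ≤ m b.1 := ⟨by omega, hr⟩
      rw [comp_eq_idx _ _ _ hr', Finset.sum_eq_single (idx b.1 (pos b + pos d - 1) hr')]
      · rw [prodC, if_pos, one_mul]
        exact ⟨rfl, h, by rw [pos_idx]; omega⟩
      · intro q _ hq
        rw [prodC, if_neg, zero_mul]
        rintro ⟨h1, -, h3⟩
        exact hq (idx_ext h1 (by rw [pos_idx]; omega))
      · simp
    · rw [comp_of_gt _ (by omega)]
      refine Finset.sum_eq_zero fun q _ => ?_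
      rw [prodC, if_neg, zero_mul]
      rintro ⟨h1, -, h3⟩
      have := (pos_bounds q).2
      rw [h1] at this
      omega
  · refine Finset.sum_eq_zero fun q _ => ?_
    rw [prodC, if_neg, zero_mul]
    rintro ⟨h1, h2, -⟩
    exact h (h1.symm.trans h2)

theorem sum_prodC_lower (F : Idx m → ℝ) (a b : Idx m) :
    ∑ q, prodC a b q * F q = if a.1 = b.1 then comp F a.1 (pos a + 1 - pos b) else 0 := by
  have hb := pos_bounds b
  have ha := pos_bounds a
  split_ifs with h
  · by_cases hr : 1 ≤ pos a + 1 - pos b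
    · have hr' : 1 ≤ pos a + 1 - pos b ∧ pos a + 1 - pos b ≤ m a.1 := ⟨hr, by omega⟩
      rw [comp_eq_idx _ _ _ hr', Finset.sum_eq_single (idx a.1 (pos a + 1 - pos b) hr')]
      · rw [prodC, if_pos, one_mul]
        exact ⟨h, rfl, by rw [pos_idx]; omega⟩
      · intro q _ hq
        rw [prodC, if_neg, zero_mul]
        rintro ⟨-, h1, h3⟩
        exact hq (idx_ext h1.symm (by rw [pos_idx]; omega))
      · simp
    · rw [show pos a + 1 - pos b = 0 by omega, comp_at_zero]
      refine Finset.sum_eq_zero fun q _ => ?_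
      rw [prodC, if_neg, zero_mul]
      rintro ⟨-, -, h3⟩
      have := (pos_bounds q).1
      omega
  · refine Finset.sum_eq_zero fun q _ => ?_
    rw [prodC, if_neg, zero_mul]
    rintro ⟨h1, -⟩
    exact h h1

theorem sum_unitE (hm : ∀ α, 1 ≤ m α) (F : Idx m → ℝ) :
    ∑ t, unitE t * F t = ∑ σ, comp F σ 1 := by
  rw [sum_idx]
  refine Finset.sum_congr rfl fun σ _ => ?_
  rw [Finset.sum_eq_single_of_mem 0 (Finset.mem_range.2 (hm σ))]
  · rw [comp_eq_idx _ _ _ ⟨le_rfl, hm σ⟩, comp_eq_idx _ _ _ ⟨le_rfl, hm σ⟩, unitE,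
      if_pos (pos_idx _ _ _), one_mul]
  · intro l hl hl0
    have hl := Finset.mem_range.1 hl
    rw [comp_eq_idx _ _ _ ⟨by omega, by omega⟩, unitE, if_neg, zero_mul]
    rw [pos_idx]
    omega

section Extension

variable (Γ : Pt m → Idx m → Idx m → Idx m → ℝ) (u : Pt m)

theorem chr_upper_out (i : ℕ) (α : Fin r) (j : ℕ) (β : Fin r) (k : ℕ) (γ : Fin r)
    (h : ¬(1 ≤ i ∧ i ≤ m α)) : chr Γ u i α j β k γ = 0 := dif_neg h

theorem chr_left_out (i : ℕ) (α : Fin r) (j : ℕ) (β : Fin r) (k : ℕ) (γ : Fin r)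
    (h : ¬(1 ≤ j ∧ j ≤ m β)) : chr Γ u i α j β k γ = 0 := by
  simp [chr, comp, h]

theorem chr_right_out (i : ℕ) (α : Fin r) (j : ℕ) (β : Fin r) (k : ℕ) (γ : Fin r)
    (h : ¬(1 ≤ k ∧ k ≤ m γ)) : chr Γ u i α j β k γ = 0 := by
  simp [chr, comp, h]

theorem dTheta_left_out (θ : Pt m → Idx m → ℝ) (j : ℕ) (β : Fin r) (i : ℕ) (α : Fin r)
    (h : ¬(1 ≤ j ∧ j ≤ m β)) : dTheta θ u j β i α = 0 := dif_neg h

theorem dTheta_right_out (θ : Pt m → Idx m → ℝ) (j : ℕ) (β : Fin r) (i : ℕ) (α : Fin r)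
    (h : ¬(1 ≤ i ∧ i ≤ m α)) : dTheta θ u j β i α = 0 := by
  simp [dTheta, comp, h]

end Extension

/-! ### The equations of the connection in double indices. -/

theorem chr_symm {Γ : Pt m → Idx m → Idx m → Idx m → ℝ} {u : Pt m}
    (h : ∀ a b d, Γ u a b d = Γ u a d b) (i : ℕ) (α : Fin r) (j : ℕ) (β : Fin r) (k : ℕ)
    (γ : Fin r) : chr Γ u i α j β k γ = chr Γ u i α k γ j β := by
  by_cases hj : 1 ≤ j ∧ j ≤ m β
  · by_cases hk : 1 ≤ k ∧ k ≤ m γ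
    · simp only [chr, comp_eq_idx _ _ _ hj, comp_eq_idx _ _ _ hk, h]
    · rw [chr_right_out _ _ _ _ _ _ _ _ hk, chr_left_out _ _ _ _ _ _ _ _ hk]
  · rw [chr_right_out _ _ _ _ _ _ _ _ hj, chr_left_out _ _ _ _ _ _ _ _ hj]

theorem pd_const (b : Idx m) (u : Pt m) (c : ℝ) : pd b (fun _ => c) u = 0 := by
  simp [pd]

theorem pd_comp (X : Pt m → Idx m → ℝ) (b : Idx m) (u : Pt m) (α : Fin r) (i : ℕ) :
    pd b (fun v => comp (X v) α i) u = comp (fun a => pd b (fun v => X v a) u) α i := by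
  by_cases h : 1 ≤ i ∧ i ≤ m α
  · simp only [comp_eq_idx _ _ _ h]
  · simp only [comp, dif_neg h, pd_const]

/-- Vanishing of the covariant derivative of the unit, in double-index notation. -/
theorem chr_sum_unit (hm : ∀ α, 1 ≤ m α) {Γ : Pt m → Idx m → Idx m → Idx m → ℝ} {u : Pt m}
    (h : ∀ a b, covVec Γ (fun _ => unitE) u b a = 0) (i : ℕ) (α : Fin r) (j : ℕ) (β : Fin r) :
    ∑ σ, chr Γ u i α j β 1 σ = 0 := by
  by_cases hi : 1 ≤ i ∧ i ≤ m α
  · by_cases hj : 1 ≤ j ∧ j ≤ m β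
    · have e := h (idx α i hi) (idx β j hj)
      simp only [covVec, pd_const, zero_add] at e
      rw [Finset.sum_congr rfl fun s _ => mul_comm _ _, sum_unitE hm] at e
      simpa only [chr, comp_eq_idx _ _ _ hi, comp_eq_idx _ _ _ hj] using e
    · exact Finset.sum_eq_zero fun σ _ => chr_left_out _ _ _ _ _ _ _ _ hj
  · exact Finset.sum_eq_zero fun σ _ => chr_upper_out _ _ _ _ _ _ _ _ hi

theorem mulOp_eq (X : Pt m → Idx m → ℝ) (u : Pt m) (i j : Idx m) :
    mulOp X u i j = if i.1 = j.1 then comp (X u) i.1 (pos i + 1 - pos j) else 0 :=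
  sum_prodC_lower _ _ _

theorem pd_mulOp (X : Pt m → Idx m → ℝ) (u : Pt m) (b i j : Idx m) :
    pd b (fun v => mulOp X v i j) u
      = if i.1 = j.1 then dTheta X u (pos b) b.1 (pos i + 1 - pos j) i.1 else 0 := by
  simp only [mulOp_eq]
  split_ifs with h
  · rw [pd_comp, dTheta, comp_pos (fun b => comp (fun a => pd b (fun v => X v a) u) i.1 _) b]
  · exact pd_const b u 0

theorem sum_mul_mulOp (X : Pt m → Idx m → ℝ) (u : Pt m) (F : Idx m → ℝ) (k : Idx m) :
    ∑ s, F s * mulOp X u s k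
      = ∑ l ∈ Finset.range (m k.1), comp (X u) k.1 (l + 1) * comp F k.1 (pos k + l) := by
  have e : ∑ s, F s * mulOp X u s k = ∑ t, X u t * ∑ s, prodC s k t * F s := by
    simp only [mulOp, Finset.mul_sum]
    rw [Finset.sum_comm]
    exact Finset.sum_congr rfl fun _ _ => Finset.sum_congr rfl fun _ _ => by ring
  rw [e, sum_idx, Finset.sum_eq_single k.1]
  · refine Finset.sum_congr rfl fun l hl => ?_
    have hl := Finset.mem_range.1 hl
    have hl' : 1 ≤ l + 1 ∧ l + 1 ≤ m k.1 := ⟨by omega, hl⟩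
    rw [comp_eq_idx _ _ _ hl', comp_eq_idx _ _ _ hl', sum_prodC_upper, pos_idx]
    exact congrArg _ (if_pos rfl)
  · intro γ _ hγ
    refine Finset.sum_eq_zero fun l hl => ?_
    have hl := Finset.mem_range.1 hl
    have hl' : 1 ≤ l + 1 ∧ l + 1 ≤ m γ := ⟨by omega, hl⟩
    rw [comp_eq_idx _ _ _ hl', sum_prodC_upper, if_neg fun h => hγ h.symm, mul_zero]
  · simp

/-- The equation `d_∇ (X ∘) = 0`, in double-index notation. -/
theorem dnabla_eq {X : Pt m → Idx m → ℝ} {Γ : Pt m → Idx m → Idx m → Idx m → ℝ} {u : Pt m}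
    (ht : ∀ a b d, Γ u a b d = Γ u a d b) (h : ∀ i j k, extCov Γ (mulOp X) u i j k = 0)
    (i : ℕ) (α : Fin r) (j : ℕ) (β : Fin r) (k : ℕ) (γ : Fin r) (hi : i ≤ m α) (hj : 1 ≤ j)
    (hk : 1 ≤ k) :
    (if α = γ then dTheta X u j β (i + 1 - k) α else 0)
      + ∑ l ∈ Finset.range (m γ), comp (X u) γ (l + 1) * chr Γ u i α j β (k + l) γ
      = (if α = β then dTheta X u k γ (i + 1 - j) α else 0)
      + ∑ l ∈ Finset.range (m β), comp (X u) β (l + 1) * chr Γ u i α k γ (j + l) β := by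
  by_cases hi0 : i = 0
  · subst hi0
    simp [chr_upper_out, show 1 - j = 0 by omega, show 1 - k = 0 by omega, dTheta_right_out]
  by_cases hjm : m β < j
  · have : α = β → i + 1 - j = 0 := by rintro rfl; omega
    rw [Finset.sum_eq_zero fun l _ => by rw [chr_left_out _ _ _ _ _ _ _ _ (by omega), mul_zero],
      Finset.sum_eq_zero fun l _ => by rw [chr_right_out _ _ _ _ _ _ _ _ (by omega), mul_zero],
      dTheta_left_out _ _ _ _ _ _ (by omega), ite_self]
    split_ifs with hab
    · rw [this hab, dTheta_right_out _ _ _ _ _ _ (by omega)]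
    · rfl
  by_cases hkm : m γ < k
  · have : α = γ → i + 1 - k = 0 := by rintro rfl; omega
    rw [Finset.sum_eq_zero fun l _ => by rw [chr_right_out _ _ _ _ _ _ _ _ (by omega), mul_zero],
      Finset.sum_eq_zero fun l _ => by rw [chr_left_out _ _ _ _ _ _ _ _ (by omega), mul_zero],
      dTheta_left_out _ _ k _ _ _ (by omega), ite_self]
    split_ifs with hab
    · rw [this hab, dTheta_right_out _ _ _ _ _ _ (by omega)]
    · rfl
  have hi' : 1 ≤ i ∧ i ≤ m α := by omega
  have hj' : 1 ≤ j ∧ j ≤ m β := by omega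
  have hk' : 1 ≤ k ∧ k ≤ m γ := by omega
  have e := h (idx α i hi') (idx β j hj') (idx γ k hk')
  simp only [extCov, covEnd, pd_mulOp, sum_mul_mulOp, pos_idx] at e
  simp only [ht _ (idx γ k hk') (idx β j hj')] at e
  simp only [chr, comp_eq_idx _ _ _ hi', comp_eq_idx _ _ _ hj', comp_eq_idx _ _ _ hk']
  -- After torsion-freeness, the terms `Γ^s_{jk} V^i_s` of the two covariant derivatives coincide
  -- and cancel.
  rw [sub_sub_sub_cancel_right, sub_eq_zero] at e
  exact e

theorem pd_eq_zero_of_dependsOnlyUpTo {U : Set (Pt m)} (hU : IsOpen U) {i : ℕ} {f : Pt m → ℝ}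
    (hf : DependsOnlyUpTo U i f) {u : Pt m} (hu : u ∈ U) {b : Idx m} (hb : i < pos b) :
    pd b f u = 0 := by
  by_cases hd : DifferentiableAt ℝ f u
  · obtain ⟨W, hW, h⟩ := hf u hu
    have hl := hd.hasFDerivAt.hasLineDerivAt (Pi.single b 1)
    have hc : Filter.Tendsto (fun t : ℝ => u + t • (Pi.single b 1 : Pt m)) (𝓝 0) (𝓝 u) := by
      have : Continuous fun t : ℝ => u + t • (Pi.single b 1 : Pt m) := by fun_prop
      simpa using this.tendsto 0
    have hev : (fun t : ℝ => f (u + t • (Pi.single b 1 : Pt m))) =ᶠ[𝓝 0] fun _ => f u := by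
      filter_upwards [hc (Filter.inter_mem hW (hU.mem_nhds hu))] with t ht
      refine h _ ht _ ⟨mem_of_mem_nhds hW, hu⟩ fun a ha => ?_
      have : a ≠ b := by rintro rfl; omega
      simp [this]
    exact HasDerivAt.unique hl ((hasDerivAt_const (0 : ℝ) (f u)).congr_of_eventuallyEq hev)
  -- Without differentiability the default value of `fderiv` is already zero.
  · rw [pd, fderiv_zero_of_not_differentiableAt hd]
    rfl

theorem dTheta_eq_zero_of_depends {U : Set (Pt m)} (hU : IsOpen U) {X : Pt m → Idx m → ℝ}
    (hX : ∀ a, DependsOnlyUpTo U (pos a) (fun u => X u a)) {u : Pt m} (hu : u ∈ U)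
    (j : ℕ) (β : Fin r) (i : ℕ) (α : Fin r) (hij : i < j) : dTheta X u j β i α = 0 := by
  by_cases hj : 1 ≤ j ∧ j ≤ m β
  · by_cases hi : 1 ≤ i ∧ i ≤ m α
    · rw [dTheta, comp_eq_idx _ _ _ hj, comp_eq_idx _ _ _ hi]
      exact pd_eq_zero_of_dependsOnlyUpTo hU (hX _) hu (by rwa [pos_idx, pos_idx])
    · exact dTheta_right_out _ _ _ _ _ _ hi
  · exact dTheta_left_out _ _ _ _ _ _ hj

/-! ### The metric system in double indices. -/

/-- The metric system at `u`, in double-index notation. -/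
theorem metric_eq_iff (hm : ∀ α, 1 ≤ m α) (Γ : Pt m → Idx m → Idx m → Idx m → ℝ)
    (θ : Pt m → Idx m → ℝ) (u : Pt m) (h i j : Idx m) :
    (∑ q, prodC q h j * pd i (fun v => θ v q) u + ∑ q, prodC q i h * pd j (fun v => θ v q) u
        - ∑ s, prodC s i j * pd s (fun v => θ v h) u
      = 2 * ∑ q, ∑ s, prodC q h s * Γ u s i j * θ u q
        + ∑ s, ∑ q, ∑ t, prodC s i j * prodC q h s * unitE t * pd t (fun v => θ v q) u) ↔
    ((if h.1 = j.1 then dTheta θ u (pos i) i.1 (pos h + pos j - 1) h.1 else 0)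
      + (if h.1 = i.1 then dTheta θ u (pos j) j.1 (pos h + pos i - 1) h.1 else 0)
      - (if i.1 = j.1 then dTheta θ u (pos i + pos j - 1) i.1 (pos h) h.1 else 0)
      = 2 * ∑ s ∈ Finset.range (m h.1 + 1),
            chr Γ u s h.1 (pos i) i.1 (pos j) j.1 * comp (θ u) h.1 (pos h + s - 1)
        + if i.1 = j.1 ∧ h.1 = i.1 then
            ∑ σ, dTheta θ u 1 σ (pos h + pos i + pos j - 2) h.1 else 0) := by
  have e1 : ∑ q, ∑ s, prodC q h s * Γ u s i j * θ u q = ∑ s ∈ Finset.range (m h.1 + 1),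
      chr Γ u s h.1 (pos i) i.1 (pos j) j.1 * comp (θ u) h.1 (pos h + s - 1) := by
    rw [Finset.sum_comm]
    have : ∀ s, ∑ q, prodC q h s * Γ u s i j * θ u q
        = Γ u s i j * ∑ q, prodC q h s * θ u q := fun s => by
      rw [Finset.mul_sum]
      exact Finset.sum_congr rfl fun q _ => by ring
    simp only [this, sum_prodC_upper]
    -- The range includes the null position `s = 0`, so that `sum_shift` applies to these sums.
    rw [sum_idx, Finset.sum_range_succ', chr_upper_out _ _ _ _ _ _ _ _ (by omega), zero_mul,
      add_zero, Finset.sum_eq_single h.1]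
    · refine Finset.sum_congr rfl fun l hl => ?_
      have hl := Finset.mem_range.1 hl
      have hl' : 1 ≤ l + 1 ∧ l + 1 ≤ m h.1 := ⟨by omega, hl⟩
      rw [comp_eq_idx _ _ _ hl', if_pos (show h.1 = (idx h.1 (l + 1) hl' : Idx m).1 from rfl),
        pos_idx]
      simp only [chr, comp_pos, comp_eq_idx _ _ _ hl']
    · intro γ _ hγ
      refine Finset.sum_eq_zero fun l hl => ?_
      have hl := Finset.mem_range.1 hl
      have hl' : 1 ≤ l + 1 ∧ l + 1 ≤ m γ := ⟨by omega, hl⟩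
      rw [comp_eq_idx _ _ _ hl', if_neg fun h => hγ h.symm, mul_zero]
    · simp
  have e2 : ∑ s, ∑ q, ∑ t, prodC s i j * prodC q h s * unitE t * pd t (fun v => θ v q) u
      = if i.1 = j.1 ∧ h.1 = i.1 then
            ∑ σ, dTheta θ u 1 σ (pos h + pos i + pos j - 2) h.1 else 0 := by
    have : ∀ s, ∑ q, ∑ t, prodC s i j * prodC q h s * unitE t * pd t (fun v => θ v q) u
        = prodC s i j * ∑ q, prodC q h s * ∑ t, unitE t * pd t (fun v => θ v q) u := fun s => by
      simp only [Finset.mul_sum]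
      exact Finset.sum_congr rfl fun q _ => Finset.sum_congr rfl fun t _ => by ring
    simp only [this, sum_unitE hm]
    rw [sum_prodC_upper]
    have hi := pos_bounds i
    have hj := pos_bounds j
    have hh := pos_bounds h
    by_cases hij : i.1 = j.1
    · rw [if_pos hij]
      by_cases hr : 1 ≤ pos i + pos j - 1 ∧ pos i + pos j - 1 ≤ m i.1
      · rw [comp_eq_idx _ _ _ hr, sum_prodC_upper, pos_idx]
        have hb : (idx i.1 (pos i + pos j - 1) hr : Idx m).1 = i.1 := rfl
        rw [hb]
        by_cases hhi : h.1 = i.1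
        · rw [if_pos hhi, if_pos ⟨hij, hhi⟩,
            show pos h + (pos i + pos j - 1) - 1 = pos h + pos i + pos j - 2 by omega]
          by_cases hs : 1 ≤ pos h + pos i + pos j - 2 ∧ pos h + pos i + pos j - 2 ≤ m h.1
          · rw [comp_eq_idx _ _ _ hs]
            simp only [dTheta, comp_eq_idx _ _ _ hs]
          · rw [comp, dif_neg hs, Finset.sum_eq_zero fun σ _ => dTheta_right_out _ _ _ _ _ _ hs]
        · rw [if_neg hhi, if_neg fun h => hhi h.2]
      · rw [comp, dif_neg hr]
        by_cases hhi : h.1 = i.1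
        · rw [if_pos ⟨hij, hhi⟩, Finset.sum_eq_zero fun σ _ => dTheta_right_out _ _ _ _ _ _ ?_]
          rw [hhi]
          omega
        · rw [if_neg fun h => hhi h.2]
    · rw [if_neg hij, if_neg fun h => hij h.1]
  rw [e1, e2, sum_prodC_upper, sum_prodC_upper, sum_prodC_upper]
  have e3 : (if i.1 = h.1 then comp (fun q => pd j (fun v => θ v q) u) i.1 (pos i + pos h - 1)
      else 0) = if h.1 = i.1 then dTheta θ u (pos j) j.1 (pos h + pos i - 1) h.1 else 0 := by
    simp only [eq_comm (a := i.1) (b := h.1)]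
    split_ifs with hhi
    · rw [dTheta, comp_pos (fun b => comp (fun a => pd b (fun v => θ v a) u) h.1 _) j, hhi,
        add_comm]
    · rfl
  have e4 : comp (fun q => pd i (fun v => θ v q) u) h.1 (pos h + pos j - 1)
      = dTheta θ u (pos i) i.1 (pos h + pos j - 1) h.1 := by
    rw [dTheta, comp_pos (fun b => comp (fun a => pd b (fun v => θ v a) u) h.1 _) i]
  have e5 : comp (fun s => pd s (fun v => θ v h) u) i.1 (pos i + pos j - 1)
      = dTheta θ u (pos i + pos j - 1) i.1 (pos h) h.1 := by
    simp only [dTheta, comp_pos]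
  rw [e3, e4, e5]


/-! ### Reduction of the one-block system to degree two. -/

/-- Within one block, the metric system reduces to equations which involve only degree two. -/
theorem block_system_iff {p : ℕ} (hp : 1 ≤ p) {N : ℕ → ℕ → ℕ → ℝ} {a : ℕ → ℕ → ℝ} {t : ℕ → ℝ}
    (hN : ∀ i j k, N i j k = N i k j) (h0 : ∀ j k, N 0 j k = 0)
    (h1 : ∀ i k, i ≤ p → 1 ≤ k → N i 1 k = N (i + 1 - k) 1 1)
    (hv : ∀ i j k, i ≤ p → 1 ≤ j → 1 ≤ k → i + 2 < j + k → N i j k = 0)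
    (hc : ∀ i j k, i ≤ p → 1 ≤ j → 1 ≤ k →
      defect N i j (k + 1) - defect N i (j + 1) k
        = defect N (i + 1 - k) j 2 - defect N (i + 1 - j) k 2)
    (haj : ∀ j h, p < j → a j h = 0) (hah : ∀ j h, p < h → a j h = 0)
    (ht : ∀ n, p < n → t n = 0) :
    (∀ h i j, 1 ≤ h → h ≤ p → 1 ≤ i → i ≤ p → 1 ≤ j → j ≤ p →
      a i (h + j - 1) + a j (h + i - 1) - a (i + j - 1) h - a 1 (h + i + j - 2)
        = 2 * ∑ s ∈ Finset.range (p + 1), defect N s i j * t (h + s - 1)) ↔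
    (∀ i j, 1 ≤ i → i ≤ p → 1 ≤ j → j ≤ p → p + 3 ≤ i + j → a j i = 0) ∧
    (2 ≤ p → a 2 p = 2 / (p : ℝ) * (∑ k ∈ Finset.Icc 2 p, N k 2 k) * t p) ∧
    (∀ i j, 1 ≤ i → i + 1 ≤ p → 3 ≤ j → j ≤ p → i + j ≤ p + 2 →
      a j i = a (j - 1) (i + 1) + a 2 (i + j - 2) - a 1 (i + j - 1)
        + 2 * ∑ s ∈ Finset.Icc (j - 1) (p + 1 - i),
            (N (s + 1 - j) 1 1 - N s 2 (j - 1)) * t (i + s - 1)) := by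
  have vanish : ∀ h j, 1 ≤ h → 1 ≤ j → p + 2 ≤ h + j →
      ∑ s ∈ Finset.range (p + 1), defect N s 2 j * t (h + s - 1) = 0 := by
    intro h j hh hj hhj
    refine Finset.sum_eq_zero fun s hs => ?_
    have hs := Finset.mem_range.1 hs
    rcases Nat.lt_or_ge s j with hsj | hsj
    · rw [defect_low h0 hv s 2 j (by omega) (by omega) hj (by omega), zero_mul]
    · rw [ht _ (by omega), mul_zero]
  have sumIcc : ∀ h j, 1 ≤ h → 1 ≤ j →
      ∑ s ∈ Finset.range (p + 1), defect N s 2 j * t (h + s - 1)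
        = ∑ s ∈ Finset.Icc j (p + 1 - h), (N s 2 j - N (s - j) 1 1) * t (h + s - 1) := by
    intro h j hh hj
    have e : ∀ s, defect N s 2 j = N s 2 j - N (s - j) 1 1 := fun s => by
      rw [defect, show s + 2 - 2 - j = s - j by omega]
    rw [← Finset.sum_subset (s₁ := Finset.Icc j (p + 1 - h))]
    · exact Finset.sum_congr rfl fun s _ => by rw [e]
    · intro s hs
      have := Finset.mem_Icc.1 hs
      exact Finset.mem_range.2 (by omega)
    · intro s hs hs'
      have hs := Finset.mem_range.1 hs
      rw [Finset.mem_Icc] at hs'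
      rcases Nat.lt_or_ge s j with hsj | hsj
      · rw [defect_low h0 hv s 2 j (by omega) (by omega) hj (by omega), zero_mul]
      · rw [ht _ (by omega), mul_zero]
  have corner : ∀ j, 1 ≤ j → j ≤ p →
      ∑ s ∈ Finset.range (p + 1), defect N s 2 j * t (p + 1 - j + s - 1) = N j 2 j * t p := by
    intro j hj hjp
    rw [sumIcc (p + 1 - j) j (by omega) hj, show p + 1 - (p + 1 - j) = j by omega,
      Finset.Icc_self, Finset.sum_singleton, Nat.sub_self, h0, sub_zero,
      show p + 1 - j + j - 1 = p by omega]
  constructor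
  · intro H
    have H2 : ∀ h j, 2 ≤ p → 1 ≤ h → h ≤ p → 1 ≤ j → j ≤ p →
        a 2 (h + j - 1) + a j (h + 1) - a (j + 1) h - a 1 (h + j)
          = 2 * ∑ s ∈ Finset.range (p + 1), defect N s 2 j * t (h + s - 1) := by
      intro h j hp2 hh hhp hj hjp
      have e := H h 2 j hh hhp (by omega) hp2 hj hjp
      rwa [show h + 2 - 1 = h + 1 by omega, show 2 + j - 1 = j + 1 by omega,
        show h + 2 + j - 2 = h + j by omega] at e
    -- Descending induction on `j`: beyond total degree `p + 2`, the degree-two equation equates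
    -- consecutive entries of an antidiagonal, and the last one lies outside the block.
    have zeros : ∀ d i j, p + 1 = j + d → 1 ≤ i → 1 ≤ j → p + 3 ≤ i + j → a j i = 0 := by
      intro d
      induction d with
      | zero => intro i j h _ _ _; exact haj _ _ (by omega)
      | succ d ih =>
        intro i j hd hi hj hij
        rcases Nat.lt_or_ge p i with hip | hip
        · exact hah _ _ hip
        have e := H2 (i - 1) j (by omega) (by omega) (by omega) hj (by omega)
        rw [vanish _ _ (by omega) hj (by omega), hah 2 _ (by omega), hah 1 _ (by omega),
          ih (i - 1) (j + 1) (by omega) (by omega) (by omega) (by omega),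
          show i - 1 + 1 = i by omega] at e
        linarith
    refine ⟨fun i j hi _ hj hjp => zeros (p + 1 - j) i j (by omega) hi hj, fun hp2 => ?_,
      fun i j hi hip hj hjp hij => ?_⟩
    -- On the antidiagonal of total degree `p + 2` each equation contributes one `a 2 p` and one `N
    -- k 2 k`. At `n = p - 1` the left side is out of range, which gives the factor `2 / p`.
    · have tele : ∀ n, n + 1 ≤ p → a (n + 2) (p - n) = (n + 1) * a 2 p
          - 2 * (∑ k ∈ Finset.Ico 2 (n + 2), N k 2 k) * t p := by
        intro n
        induction n with
        | zero => intro _; simp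
        | succ n ih =>
          intro hn
          have e := H2 (p + 1 - (n + 2)) (n + 2) hp2 (by omega) (by omega) (by omega) (by omega)
          rw [corner _ (by omega) (by omega), hah 1 _ (by omega),
            show p + 1 - (n + 2) + (n + 2) - 1 = p by omega,
            show p + 1 - (n + 2) + 1 = p - n by omega, ih (by omega)] at e
          rw [Finset.sum_Ico_succ_top (by omega), show n + 1 + 2 = n + 2 + 1 by omega]
          push_cast
          rw [show p - (n + 1) = p + 1 - (n + 2) by omega]
          linarith
      have e := tele (p - 1) (by omega)
      rw [haj _ _ (by omega), show p - 1 + 2 = p + 1 by omega] at e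
      have hp' : ((p - 1 : ℕ) : ℝ) + 1 = p := by
        rw [Nat.cast_sub hp]
        push_cast
        ring
      have hp0 : (p : ℝ) ≠ 0 := by positivity
      rw [hp', Finset.Ico_add_one_right_eq_Icc] at e
      field_simp
      linarith
    · have e := H2 i (j - 1) (by omega) hi (by omega) (by omega) (by omega)
      rw [sumIcc _ _ hi (by omega), show i + (j - 1) - 1 = i + j - 2 by omega,
        show j - 1 + 1 = j by omega, show i + (j - 1) = i + j - 1 by omega] at e
      have e2 : ∑ s ∈ Finset.Icc (j - 1) (p + 1 - i),
            (N (s + 1 - j) 1 1 - N s 2 (j - 1)) * t (i + s - 1)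
          = - ∑ s ∈ Finset.Icc (j - 1) (p + 1 - i),
            (N s 2 (j - 1) - N (s - (j - 1)) 1 1) * t (i + s - 1) := by
        rw [← Finset.sum_neg_distrib]
        refine Finset.sum_congr rfl fun s _ => ?_
        rw [show s + 1 - j = s - (j - 1) by omega]
        ring
      rw [e2]
      linarith
  · rintro ⟨zeros, top, same⟩
    have zeros' : ∀ i j, 1 ≤ i → 1 ≤ j → p + 3 ≤ i + j → a j i = 0 := by
      intro i j hi hj hij
      rcases Nat.lt_or_ge p i with hip | hip
      · exact hah _ _ hip
      rcases Nat.lt_or_ge p j with hjp | hjp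
      · exact haj _ _ hjp
      exact zeros i j hi hip hj hjp hij
    have inner : ∀ h j, 1 ≤ h → 2 ≤ j → j + 1 ≤ p → h + j ≤ p + 1 →
        a 2 (h + j - 1) + a j (h + 1) - a (j + 1) h - a 1 (h + j)
          = 2 * ∑ s ∈ Finset.range (p + 1), defect N s 2 j * t (h + s - 1) := by
      intro h j hh hj hjp hhj
      have e := same h (j + 1) hh (by omega) (by omega) hjp (by omega)
      rw [Nat.add_sub_cancel, show h + (j + 1) - 2 = h + j - 1 by omega,
        show h + (j + 1) - 1 = h + j by omega] at e
      rw [sumIcc _ _ hh (by omega), e]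
      have e2 : ∑ s ∈ Finset.Icc j (p + 1 - h), (N (s + 1 - (j + 1)) 1 1 - N s 2 j) * t (h + s - 1)
          = - ∑ s ∈ Finset.Icc j (p + 1 - h), (N s 2 j - N (s - j) 1 1) * t (h + s - 1) := by
        rw [← Finset.sum_neg_distrib]
        refine Finset.sum_congr rfl fun s _ => ?_
        rw [show s + 1 - (j + 1) = s - j by omega]
        ring
      rw [e2]
      ring
    -- The equation at `h = 1`, `j = p` is not among the given ones. It is recovered by telescoping
    -- up to it and using `top`.
    have last : 2 ≤ p → a 2 p + a p 2 = 2 * (N p 2 p * t p) := by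
      intro hp2
      have tele : ∀ n, n + 2 ≤ p → a (n + 2) (p - n) = (n + 1) * a 2 p
          - 2 * (∑ k ∈ Finset.Ico 2 (n + 2), N k 2 k) * t p := by
        intro n
        induction n with
        | zero => intro _; simp
        | succ n ih =>
          intro hn
          have e := inner (p + 1 - (n + 2)) (n + 2) (by omega) (by omega) (by omega) (by omega)
          rw [corner _ (by omega) (by omega), hah 1 _ (by omega),
            show p + 1 - (n + 2) + (n + 2) - 1 = p by omega,
            show p + 1 - (n + 2) + 1 = p - n by omega, ih (by omega)] at e
          rw [Finset.sum_Ico_succ_top (by omega), show n + 1 + 2 = n + 2 + 1 by omega]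
          push_cast
          rw [show p - (n + 1) = p + 1 - (n + 2) by omega]
          linarith
      have e := tele (p - 2) (by omega)
      have e2 := top hp2
      rw [← Finset.Ico_add_one_right_eq_Icc, Finset.sum_Ico_succ_top hp2] at e2
      rw [show p - 2 + 2 = p by omega, show p - (p - 2) = 2 by omega] at e
      have hp' : ((p - 2 : ℕ) : ℝ) + 1 = p - 1 := by
        rw [Nat.cast_sub hp2]
        push_cast
        ring
      have hp0 : (p : ℝ) ≠ 0 := by positivity
      rw [hp'] at e
      field_simp at e2
      linarith
    have B2 : ∀ h j, 1 ≤ h → 1 ≤ j → j ≤ p →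
        a 2 (h + j - 1) + a j (h + 1) - a (j + 1) h - a 1 (h + j)
          = 2 * ∑ s ∈ Finset.range (p + 1), defect N s 2 j * t (h + s - 1) := by
      intro h j hh hj hjp
      rcases Nat.eq_or_lt_of_le hj with rfl | hj2
      · rw [Finset.sum_eq_zero fun s hs => by
          rw [defect_symm hN, defect_one h1 s 2 (by have := Finset.mem_range.1 hs; omega)
            (by omega), zero_mul]]
        rw [Nat.add_sub_cancel]
        ring
      rcases Nat.lt_or_ge (p + 1) (h + j) with hhj | hhj
      · rw [vanish _ _ hh hj (by omega), hah 2 _ (by omega), hah 1 _ (by omega),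
          zeros' _ _ (by omega) hj (by omega), zeros' _ _ hh (by omega) (by omega)]
        ring
      rcases Nat.lt_or_ge j p with hjp2 | hjp2
      · exact inner h j hh hj2 hjp2 hhj
      · obtain rfl : j = p := by omega
        obtain rfl : h = 1 := by omega
        have e := corner j hj le_rfl
        rw [show j + 1 - j = 1 by omega] at e
        rw [e, ← last (by omega), haj (j + 1) _ (by omega), hah 1 _ (by omega),
          show 1 + j - 1 = j by omega]
        ring
    -- The induction trades `(i + 1, j)` for `(i, j + 1)`, so `j` and `h` must be allowed to leave
    -- the block.
    suffices B : ∀ i, 1 ≤ i → i ≤ p → ∀ j, 1 ≤ j → ∀ h, 1 ≤ h →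
        a i (h + j - 1) + a j (h + i - 1) - a (i + j - 1) h - a 1 (h + i + j - 2)
          = 2 * ∑ s ∈ Finset.range (p + 1), defect N s i j * t (h + s - 1) from
      fun h i j hh _ hi hip hj _ => B i hi hip j hj h hh
    intro i hi
    induction i, hi using Nat.le_induction with
    | base =>
      intro _ j hj h hh
      rw [Finset.sum_eq_zero fun s hs => by
        rw [defect_one h1 s j (by have := Finset.mem_range.1 hs; omega) hj, zero_mul]]
      rw [Nat.add_sub_cancel, Nat.add_sub_cancel_left, show h + 1 + j - 2 = h + j - 1 by omega]
      ring
    | succ i hi ih =>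
      intro hip j hj h hh
      rcases Nat.lt_or_ge p j with hjp | hjp
      · rw [Finset.sum_eq_zero fun s hs => by
          rw [defect_low h0 hv s _ _ (by have := Finset.mem_range.1 hs; omega) (by omega) hj
            (by have := Finset.mem_range.1 hs; omega), zero_mul]]
        rw [hah (i + 1) _ (by omega), haj _ _ hjp, haj _ _ (by omega), hah 1 _ (by omega)]
        ring
      have e0 := ih (by omega) (j + 1) (by omega) h hh
      have e1 := B2 (h + j - 1) i (by omega) hi (by omega)
      have e2 := B2 (h + i - 1) j (by omega) hj hjp
      have z : ∀ j, 1 ≤ j → defect N 0 j 2 = 0 := fun j hj => defect_zero h0 _ _ (by omega)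
      have s1 := sum_shift (F := fun s => defect N s i 2) (z i hi) ht h hh (j - 1)
      have s2 := sum_shift (F := fun s => defect N s j 2) (z j hj) ht h hh (i - 1)
      beta_reduce at s1 s2
      rw [show h + (j - 1) = h + j - 1 by omega] at s1
      rw [show h + (i - 1) = h + i - 1 by omega] at s2
      simp only [defect_symm hN _ 2] at e1 e2
      rw [← s1] at e1
      rw [← s2] at e2
      -- The cocycle identity, contracted with `t`. The derivative sides satisfy the same relation
      -- between the equation at `(i, j + 1)` and two degree-two equations.
      have key : ∑ s ∈ Finset.range (p + 1), defect N s (i + 1) j * t (h + s - 1)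
          = ∑ s ∈ Finset.range (p + 1), defect N s i (j + 1) * t (h + s - 1)
          - ∑ s ∈ Finset.range (p + 1), defect N (s - (j - 1)) i 2 * t (h + s - 1)
          + ∑ s ∈ Finset.range (p + 1), defect N (s - (i - 1)) j 2 * t (h + s - 1) := by
        rw [← Finset.sum_sub_distrib, ← Finset.sum_add_distrib]
        refine Finset.sum_congr rfl fun s hs => ?_
        have e := hc s i j (by have := Finset.mem_range.1 hs; omega) hi hj
        rw [show s + 1 - j = s - (j - 1) by omega, show s + 1 - i = s - (i - 1) by omega] at e
        rw [← sub_mul, ← add_mul]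
        congr 1
        linarith
      rw [key]
      rw [show h + j - 1 + i - 1 = h + i + j - 2 by omega, show h + j - 1 + 1 = h + j by omega,
        show h + j - 1 + i = h + i + j - 1 by omega] at e1
      rw [show h + i - 1 + j - 1 = h + i + j - 2 by omega, show h + i - 1 + 1 = h + i by omega,
        show h + i - 1 + j = h + i + j - 1 by omega] at e2
      rw [show h + (j + 1) - 1 = h + j by omega, show i + (j + 1) - 1 = i + j by omega,
        show h + i + (j + 1) - 2 = h + i + j - 1 by omega] at e0
      rw [show h + (i + 1) - 1 = h + i by omega, show i + 1 + j - 1 = i + j by omega,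
        show h + (i + 1) + j - 2 = h + i + j - 1 by omega]
      linarith

/-! ### Structure of the Christoffel symbols. -/

section Connection

variable {U : Set (Pt m)} {X : Pt m → Idx m → ℝ} {Γ : Pt m → Idx m → Idx m → Idx m → ℝ}
  {u : Pt m}

theorem IsDarbouxTsarev.chr_comm (hDT : IsDarbouxTsarev U X Γ) (hu : u ∈ U) (i : ℕ) (α : Fin r)
    (j : ℕ) (β : Fin r) (k : ℕ) (γ : Fin r) : chr Γ u i α j β k γ = chr Γ u i α k γ j β :=
  chr_symm (hDT.connection.torsionless u hu) i α j β k γ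

theorem IsDarbouxTsarev.chr_unit (hm : ∀ α, 1 ≤ m α) (hDT : IsDarbouxTsarev U X Γ) (hu : u ∈ U)
    (i : ℕ) (α : Fin r) (j : ℕ) (β : Fin r) : ∑ σ, chr Γ u i α j β 1 σ = 0 :=
  chr_sum_unit hm (hDT.connection.flat_unit u hu) i α j β

theorem IsDarbouxTsarev.chr_eq (hDT : IsDarbouxTsarev U X Γ) (hu : u ∈ U)
    (i : ℕ) (α : Fin r) (j : ℕ) (β : Fin r) (k : ℕ) (γ : Fin r) (hi : i ≤ m α) (hj : 1 ≤ j)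
    (hk : 1 ≤ k) :
    (if α = γ then dTheta X u j β (i + 1 - k) α else 0)
      + ∑ l ∈ Finset.range (m γ), comp (X u) γ (l + 1) * chr Γ u i α j β (k + l) γ
      = (if α = β then dTheta X u k γ (i + 1 - j) α else 0)
      + ∑ l ∈ Finset.range (m β), comp (X u) β (l + 1) * chr Γ u i α k γ (j + l) β :=
  dnabla_eq (hDT.connection.torsionless u hu) (hDT.connection.d_nabla u hu) i α j β k γ hi hj hk

theorem IsDarbouxTsarev.chr_distinct (hm : ∀ α, 1 ≤ m α) (hDT : IsDarbouxTsarev U X Γ)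
    (hu : u ∈ U) {α β γ : Fin r} (hαβ : α ≠ β) (hαγ : α ≠ γ) (hβγ : β ≠ γ) (i j k : ℕ) :
    chr Γ u i α j β k γ = 0 := by
  by_cases hi : 1 ≤ i ∧ i ≤ m α
  swap
  · exact chr_upper_out _ _ _ _ _ _ _ _ hi
  by_cases hj : 1 ≤ j
  swap
  · exact chr_left_out _ _ _ _ _ _ _ _ (by omega)
  by_cases hk : 1 ≤ k
  swap
  · exact chr_right_out _ _ _ _ _ _ _ _ (by omega)
  refine sylvester_unique (hm β) (hm γ) (a := fun l => comp (X u) γ (l + 1))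
    (b := fun l => comp (X u) β (l + 1)) (hDT.distinct u hu _ _ hβγ.symm)
    (S := fun _ _ => True) (fun _ _ _ _ => ⟨trivial, trivial⟩)
    (N := fun j k => chr Γ u i α j β k γ)
    (fun j k h => chr_left_out _ _ _ _ _ _ _ _ (by omega))
    (fun j k h => chr_right_out _ _ _ _ _ _ _ _ (by omega)) ?_ j k hj hk trivial
  intro j k hj hk _
  have e := hDT.chr_eq hu i α j β k γ hi.2 hj hk
  rw [if_neg hαγ, if_neg hαβ, zero_add, zero_add] at e
  simpa only [hDT.chr_comm hu i α k γ] using e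

theorem IsDarbouxTsarev.chr_mixed (hm : ∀ α, 1 ≤ m α) (hDT : IsDarbouxTsarev U X Γ)
    (hu : u ∈ U) {α β : Fin r} (hαβ : α ≠ β) (i j k : ℕ) (hi : i ≤ m α) (hj : 1 ≤ j)
    (hk : 1 ≤ k) : chr Γ u i α j β k α = chr Γ u (i + 1 - k) α j β 1 α := by
  refine toeplitz_of_sylvester (hm α) (hm β) (a := fun l => comp (X u) α (l + 1))
    (b := fun l => comp (X u) β (l + 1)) (hDT.distinct u hu _ _ hαβ)
    (M := fun j i k => chr Γ u i α j β k α) (D := fun j i => dTheta X u j β i α)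
    (fun j k => chr_upper_out _ _ _ _ _ _ _ _ (by omega))
    (fun j i k h => chr_left_out _ _ _ _ _ _ _ _ (by omega))
    (fun j i k h => chr_right_out _ _ _ _ _ _ _ _ (by omega)) ?_ i j k hi hj hk
  intro i j k hi hj hk
  have e := hDT.chr_eq hu i α j β k α hi hj hk
  rw [if_pos rfl, if_neg hαβ, zero_add] at e
  simpa only [hDT.chr_comm hu i α k α] using e

/-- In the region `j + k > i + 1`, which is stable under raising `j` or `k`, the derivatives of `X`
vanish and the Sylvester equation becomes homogeneous. -/
theorem IsDarbouxTsarev.chr_mixed_low (hm : ∀ α, 1 ≤ m α) (hU : IsOpen U)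
    (hDT : IsDarbouxTsarev U X Γ) (hu : u ∈ U) {α β : Fin r} (hαβ : α ≠ β) (i j : ℕ)
    (hj : 1 ≤ j) (hij : i < j) : chr Γ u i α j β 1 α = 0 := by
  by_cases hi : 1 ≤ i ∧ i ≤ m α
  swap
  · exact chr_upper_out _ _ _ _ _ _ _ _ hi
  refine sylvester_unique (hm β) (hm α) (a := fun l => comp (X u) α (l + 1))
    (b := fun l => comp (X u) β (l + 1)) (hDT.distinct u hu _ _ hαβ)
    (S := fun j k => i + 1 < j + k) (fun _ _ _ h => ⟨by omega, by omega⟩)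
    (N := fun j k => chr Γ u i α j β k α)
    (fun j k h => chr_left_out _ _ _ _ _ _ _ _ (by omega))
    (fun j k h => chr_right_out _ _ _ _ _ _ _ _ (by omega)) ?_ j 1 hj le_rfl (by omega)
  intro j k hj hk hs
  have e := hDT.chr_eq hu i α j β k α hi.2 hj hk
  rw [if_pos rfl, if_neg hαβ, zero_add,
    dTheta_eq_zero_of_depends hU hDT.depends hu _ _ _ _ (by omega), zero_add] at e
  simpa only [hDT.chr_comm hu i α k α] using e

/-- No derivatives of `X` enter, so the symbol depends only on `j + k`. At lower indices `j + k - 1`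
and `1`, flatness of the unit leaves just two blocks, `α` and `β`, with opposite contributions. -/
theorem IsDarbouxTsarev.chr_other (hm : ∀ α, 1 ≤ m α) (hDT : IsDarbouxTsarev U X Γ)
    (hu : u ∈ U) {α β : Fin r} (hαβ : α ≠ β) (i j k : ℕ) (hj : 1 ≤ j) (hk : 1 ≤ k) :
    chr Γ u i α j β k β = - chr Γ u i α (j + k - 1) β 1 α := by
  by_cases hi : 1 ≤ i ∧ i ≤ m α
  swap
  · rw [chr_upper_out _ _ _ _ _ _ _ _ hi, chr_upper_out _ _ _ _ _ _ _ _ hi, neg_zero]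
  have e := hankel_eq (n₀ := 0) (N := fun j k => chr Γ u i α j β k β)
    (hankel_of_generator (n₀ := 0) (p := m β) (N := fun j k => chr Γ u i α j β k β)
    (x := fun l => comp (X u) β (l + 1)) (hDT.nonzero u hu β)
    (fun j k => hDT.chr_comm hu _ _ _ _ _ _)
    (fun j k h => chr_right_out _ _ _ _ _ _ _ _ (by omega)) fun j k hj hk _ => by
      have e := hDT.chr_eq hu i α j β k β hi.2 hj hk
      rwa [if_neg hαβ, if_neg hαβ, zero_add, zero_add] at e) j k hk hj (by omega)
  beta_reduce at e
  have e2 := hDT.chr_unit hm hu i α (j + k - 1) β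
  rw [Finset.sum_eq_add_of_mem α β (Finset.mem_univ _) (Finset.mem_univ _) hαβ
    fun σ _ hσ => hDT.chr_distinct hm hu hαβ hσ.1.symm hσ.2.symm _ _ _] at e2
  rw [e, hDT.chr_comm hu]
  linarith

/-- Two instances of `∇e = 0` are subtracted. By `chr_mixed` the contributions of the other blocks
agree, leaving that of `α`. -/
theorem IsDarbouxTsarev.chr_same_one (hm : ∀ α, 1 ≤ m α) (hDT : IsDarbouxTsarev U X Γ)
    (hu : u ∈ U) (α : Fin r) (i k : ℕ) (hi : i ≤ m α) (hk : 1 ≤ k) :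
    chr Γ u i α 1 α k α = chr Γ u (i + 1 - k) α 1 α 1 α := by
  have e : ∑ σ, (chr Γ u i α k α 1 σ - chr Γ u (i + 1 - k) α 1 α 1 σ) = 0 := by
    rw [Finset.sum_sub_distrib, hDT.chr_unit hm hu, hDT.chr_unit hm hu, sub_zero]
  rw [Finset.sum_eq_single α] at e
  · rw [hDT.chr_comm hu]
    exact sub_eq_zero.1 e
  · intro σ _ hσ
    rw [hDT.chr_comm hu i, hDT.chr_mixed hm hu hσ.symm i 1 k hi le_rfl hk,
      hDT.chr_comm hu _ _ _ α, sub_self]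
  · simp

/-- In these degrees the symbol depends only on `j + k`, so one lower index may be moved to `1`.
Then `chr_same_one` brings the upper position down to `0`. -/
theorem IsDarbouxTsarev.chr_same_low (hm : ∀ α, 1 ≤ m α) (hU : IsOpen U)
    (hDT : IsDarbouxTsarev U X Γ) (hu : u ∈ U) (α : Fin r) (i j k : ℕ) (hi : i ≤ m α)
    (hj : 1 ≤ j) (hk : 1 ≤ k) (h : i + 2 < j + k) : chr Γ u i α j α k α = 0 := by
  have e := hankel_eq (n₀ := i + 2) (N := fun j k => chr Γ u i α j α k α)
    (hankel_of_generator (n₀ := i + 2) (p := m α) (N := fun j k => chr Γ u i α j α k α)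
    (x := fun l => comp (X u) α (l + 1)) (hDT.nonzero u hu α)
    (fun j k => hDT.chr_comm hu _ _ _ _ _ _)
    (fun j k h => chr_right_out _ _ _ _ _ _ _ _ (by omega)) fun j k hj hk hs => by
      have e := hDT.chr_eq hu i α j α k α hi hj hk
      rwa [if_pos rfl, if_pos rfl, dTheta_eq_zero_of_depends hU hDT.depends hu _ _ _ _ (by omega),
        dTheta_eq_zero_of_depends hU hDT.depends hu _ _ _ _ (by omega), zero_add, zero_add] at e)
    j k hk hj (by omega)
  beta_reduce at e
  rw [e, hDT.chr_same_one hm hu _ _ _ hi (by omega)]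
  exact chr_upper_out _ _ _ _ _ _ _ _ (by omega)

/-! ### Splitting the metric system into cross and block parts. -/

/-- The part of the metric system involving two blocks. -/
def CrossSystem (Γ : Pt m → Idx m → Idx m → Idx m → ℝ) (θ : Pt m → Idx m → ℝ) (u : Pt m) :
    Prop :=
  ∀ α β : Fin r, α ≠ β → ∀ i j, 1 ≤ i → i ≤ m α → 1 ≤ j → j ≤ m β →
    dTheta θ u j β i α
      = 2 * ∑ s ∈ Finset.range (m α + 1), chr Γ u s α j β 1 α * comp (θ u) α (i + s - 1)

/-- The part of the metric system involving a single block. -/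
def BlockSystem (Γ : Pt m → Idx m → Idx m → Idx m → ℝ) (θ : Pt m → Idx m → ℝ) (u : Pt m)
    (α : Fin r) : Prop :=
  ∀ h i j, 1 ≤ h → h ≤ m α → 1 ≤ i → i ≤ m α → 1 ≤ j → j ≤ m α →
    dTheta θ u i α (h + j - 1) α + dTheta θ u j α (h + i - 1) α - dTheta θ u (i + j - 1) α h α
        - dTheta θ u 1 α (h + i + j - 2) α
      = 2 * ∑ s ∈ Finset.range (m α + 1),
          defect (fun i j k => chr Γ u i α j α k α) s i j * comp (θ u) α (h + s - 1)

theorem CrossSystem.extend {θ : Pt m → Idx m → ℝ} (hC : CrossSystem Γ θ u) {α β : Fin r}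
    (hαβ : α ≠ β) (i j : ℕ) (hi : 1 ≤ i) :
    dTheta θ u j β i α
      = 2 * ∑ s ∈ Finset.range (m α + 1), chr Γ u s α j β 1 α * comp (θ u) α (i + s - 1) := by
  by_cases hj : 1 ≤ j ∧ j ≤ m β
  swap
  · rw [dTheta_left_out _ _ _ _ _ _ hj, Finset.sum_eq_zero, mul_zero]
    intro s _
    rw [chr_left_out _ _ _ _ _ _ _ _ hj, zero_mul]
  by_cases hi' : i ≤ m α
  · exact hC α β hαβ i j hi hi' hj.1 hj.2
  · rw [dTheta_right_out _ _ _ _ _ _ (by omega), Finset.sum_eq_zero, mul_zero]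
    intro s _
    rcases Nat.eq_zero_or_pos s with rfl | hs
    -- At `s = 0` the position `i - 1` may still lie in the block, so it is the symbol that vanishes
    -- here.
    · rw [chr_upper_out _ _ _ _ _ _ _ _ (by omega), zero_mul]
    · rw [comp_of_gt _ (by omega), mul_zero]

theorem CrossSystem.pair (hm : ∀ α, 1 ≤ m α) (hDT : IsDarbouxTsarev U X Γ) (hu : u ∈ U)
    {θ : Pt m → Idx m → ℝ} (hC : CrossSystem Γ θ u) {α β : Fin r} (hαβ : α ≠ β) (h i j : ℕ)
    (hh : 1 ≤ h) (hi : 1 ≤ i) (hj : 1 ≤ j) :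
    dTheta θ u j β (h + i - 1) α
      = 2 * ∑ s ∈ Finset.range (m α + 1), chr Γ u s α i α j β * comp (θ u) α (h + s - 1) := by
  rw [hC.extend hαβ _ _ (by omega), show h + i - 1 = h + (i - 1) by omega,
    ← sum_shift (F := fun s => chr Γ u s α j β 1 α) (t := fun n => comp (θ u) α n)
      (chr_upper_out _ _ _ _ _ _ _ _ (by omega))
      (fun n hn => comp_of_gt _ hn) h hh (i - 1)]
  congr 1
  refine Finset.sum_congr rfl fun s hs => ?_
  have hs := Finset.mem_range.1 hs
  rw [hDT.chr_comm hu s α i, hDT.chr_mixed hm hu hαβ s j i (by omega) hj hi,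
    show s + 1 - i = s - (i - 1) by omega]

/-- The cross equations replace the derivatives along the other blocks by symbols, whose sum over
all blocks vanishes by `∇e = 0`. The correction is the `Γ_{11}` part of the defect. -/
theorem CrossSystem.sum_unit (hm : ∀ α, 1 ≤ m α) (hDT : IsDarbouxTsarev U X Γ) (hu : u ∈ U)
    {θ : Pt m → Idx m → ℝ} (hC : CrossSystem Γ θ u) (α : Fin r) (n : ℕ) (hn : 1 ≤ n) :
    ∑ σ, dTheta θ u 1 σ n α = dTheta θ u 1 α n α
      - 2 * ∑ s ∈ Finset.range (m α + 1), chr Γ u s α 1 α 1 α * comp (θ u) α (n + s - 1) := by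
  have e : ∑ σ, (dTheta θ u 1 σ n α
      - 2 * ∑ s ∈ Finset.range (m α + 1), chr Γ u s α 1 σ 1 α * comp (θ u) α (n + s - 1))
      = dTheta θ u 1 α n α
      - 2 * ∑ s ∈ Finset.range (m α + 1), chr Γ u s α 1 α 1 α * comp (θ u) α (n + s - 1) :=
    Finset.sum_eq_single_of_mem α (Finset.mem_univ _) fun σ _ hσ =>
      sub_eq_zero.2 (hC.extend hσ.symm n 1 hn)
  rw [← e, Finset.sum_sub_distrib, ← Finset.mul_sum, Finset.sum_comm]
  simp only [← Finset.sum_mul, hDT.chr_comm hu _ α 1 _ 1 α, hDT.chr_unit hm hu, zero_mul,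
    Finset.sum_const_zero, mul_zero, sub_zero]

theorem CrossSystem.same_iff (hm : ∀ α, 1 ≤ m α) (hDT : IsDarbouxTsarev U X Γ) (hu : u ∈ U)
    {θ : Pt m → Idx m → ℝ} (hC : CrossSystem Γ θ u) (α : Fin r) (h i j : ℕ)
    (hh : 1 ≤ h) (hi : 1 ≤ i) (hj : 1 ≤ j) :
    (dTheta θ u i α (h + j - 1) α + dTheta θ u j α (h + i - 1) α - dTheta θ u (i + j - 1) α h α
      = 2 * ∑ s ∈ Finset.range (m α + 1), chr Γ u s α i α j α * comp (θ u) α (h + s - 1)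
        + ∑ σ, dTheta θ u 1 σ (h + i + j - 2) α) ↔
    dTheta θ u i α (h + j - 1) α + dTheta θ u j α (h + i - 1) α - dTheta θ u (i + j - 1) α h α
        - dTheta θ u 1 α (h + i + j - 2) α
      = 2 * ∑ s ∈ Finset.range (m α + 1),
          defect (fun i j k => chr Γ u i α j α k α) s i j * comp (θ u) α (h + s - 1) := by
  have e : ∑ s ∈ Finset.range (m α + 1),
          defect (fun i j k => chr Γ u i α j α k α) s i j * comp (θ u) α (h + s - 1)
      = ∑ s ∈ Finset.range (m α + 1), chr Γ u s α i α j α * comp (θ u) α (h + s - 1)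
      - ∑ s ∈ Finset.range (m α + 1),
          chr Γ u s α 1 α 1 α * comp (θ u) α (h + i + j - 2 + s - 1) := by
    rw [show h + i + j - 2 = h + (i + j - 2) by omega,
      ← sum_shift (F := fun s => chr Γ u s α 1 α 1 α) (t := fun n => comp (θ u) α n)
      (chr_upper_out _ _ _ _ _ _ _ _ (by omega))
      (fun n hn => comp_of_gt _ hn) h hh, ← Finset.sum_sub_distrib]
    refine Finset.sum_congr rfl fun s _ => ?_
    rw [defect, sub_mul, show s + 2 - i - j = s - (i + j - 2) by omega]
  rw [e, hC.sum_unit hm hDT hu _ _ (by omega)]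
  constructor <;> intro h <;> linarith

theorem metricSystem_iff (hm : ∀ α, 1 ≤ m α) (hDT : IsDarbouxTsarev U X Γ)
    (θ : Pt m → Idx m → ℝ) :
    MetricSystem U Γ θ ↔ ∀ u ∈ U, CrossSystem Γ θ u ∧ ∀ α, BlockSystem Γ θ u α := by
  simp only [MetricSystem, metric_eq_iff hm]
  refine forall₂_congr fun u hu => ⟨fun H => ?_, fun ⟨hC, hB⟩ h i j => ?_⟩
  · have H' : ∀ δ h α i β j, (hh : 1 ≤ h ∧ h ≤ m δ) → (hi : 1 ≤ i ∧ i ≤ m α) →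
        (hj : 1 ≤ j ∧ j ≤ m β) → _ := fun δ h α i β j hh hi hj =>
      H (idx δ h hh) (idx α i hi) (idx β j hj)
    simp only [pos_idx] at H'
    simp only [idx] at H'
    have hC : CrossSystem Γ θ u := by
      intro α β hαβ i j hi hi' hj hj'
      -- Taking the second index to be `1(α)` isolates the cross equation.
      have e := H' α i α 1 β j ⟨hi, hi'⟩ ⟨le_rfl, hm α⟩ ⟨hj, hj'⟩
      simp only [hαβ, if_true, if_false, false_and, hDT.chr_comm hu _ α 1 α, Nat.add_sub_cancel,
        zero_add, sub_zero, add_zero] at e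
      exact e
    refine ⟨hC, fun α h i j hh hh' hi hi' hj hj' => ?_⟩
    have e := H' α h α i α j ⟨hh, hh'⟩ ⟨hi, hi'⟩ ⟨hj, hj'⟩
    simp only [if_true, and_self] at e
    exact (hC.same_iff hm hDT hu α h i j hh hi hj).1 e
  · have hh := pos_bounds h
    have hi := pos_bounds i
    have hj := pos_bounds j
    revert hh hi hj
    generalize pos h = h', pos i = i', pos j = j', h.1 = δ, i.1 = α, j.1 = β
    intro hh hi hj
    by_cases hαβ : α = β
    · subst hαβ
      by_cases hδ : δ = α
      · subst hδ
        rw [if_pos rfl, if_pos rfl, if_pos rfl, if_pos ⟨rfl, rfl⟩]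
        exact (hC.same_iff hm hDT hu δ h' i' j' hh.1 hi.1 hj.1).2
          (hB δ h' i' j' hh.1 hh.2 hi.1 hi.2 hj.1 hj.2)
      -- By `chr_other` this is the cross equation for `∂_{(i+j-1)(α)} θ_{h(δ)}` with both signs
      -- reversed.
      · rw [if_neg hδ, if_neg hδ, if_pos rfl, if_neg fun h => hδ h.2,
          hC.extend hδ _ _ hh.1]
        simp only [hDT.chr_other hm hu hδ _ i' j' hi.1 hj.1, neg_mul, Finset.sum_neg_distrib]
        ring
    · simp only [hαβ, if_false, false_and, sub_zero, add_zero]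
      by_cases hδα : δ = α
      · subst hδα
        simp only [hαβ, if_true, if_false, zero_add]
        exact hC.pair hm hDT hu hαβ h' i' j' hh.1 hi.1 hj.1
      · by_cases hδβ : δ = β
        · subst hδβ
          simp only [hδα, if_true, if_false, add_zero, hDT.chr_comm hu _ δ i' α]
          exact hC.pair hm hDT hu hδα h' j' i' hh.1 hj.1 hi.1
        · simp only [hδα, hδβ, if_false, hDT.chr_distinct hm hu hδα hδβ hαβ, zero_mul,
            Finset.sum_const_zero, add_zero, mul_zero]

theorem blockSystem_iff (hm : ∀ α, 1 ≤ m α) (hU : IsOpen U) (hDT : IsDarbouxTsarev U X Γ)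
    (hu : u ∈ U) (θ : Pt m → Idx m → ℝ) (α : Fin r) :
    BlockSystem Γ θ u α ↔
    (∀ i j, 1 ≤ i → i ≤ m α → 1 ≤ j → j ≤ m α → m α + 3 ≤ i + j → dTheta θ u j α i α = 0) ∧
    (2 ≤ m α → dTheta θ u 2 α (m α) α
      = 2 / (m α : ℝ) * (∑ k ∈ Finset.Icc 2 (m α), chr Γ u k α 2 α k α) * comp (θ u) α (m α)) ∧
    (∀ i j, 1 ≤ i → i + 1 ≤ m α → 3 ≤ j → j ≤ m α → i + j ≤ m α + 2 →
      dTheta θ u j α i α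
        = dTheta θ u (j - 1) α (i + 1) α + dTheta θ u 2 α (i + j - 2) α
          - dTheta θ u 1 α (i + j - 1) α
          + 2 * ∑ s ∈ Finset.Icc (j - 1) (m α + 1 - i),
              (chr Γ u (s + 1 - j) α 1 α 1 α - chr Γ u s α 2 α (j - 1) α)
                * comp (θ u) α (i + s - 1)) := by
  have hN : ∀ i j k, chr Γ u i α j α k α = chr Γ u i α k α j α :=
    fun i j k => hDT.chr_comm hu _ _ _ _ _ _
  have h0 : ∀ j k, chr Γ u 0 α j α k α = 0 :=
    fun j k => chr_upper_out _ _ _ _ _ _ _ _ (by omega)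
  have h1 := hDT.chr_same_one hm hu α
  have hv := hDT.chr_same_low hm hU hu α
  refine block_system_iff (hm α) (N := fun i j k => chr Γ u i α j α k α)
    (a := fun j i => dTheta θ u j α i α) (t := fun n => comp (θ u) α n) hN h0 h1 hv
    (defect_cocycle (x := fun l => comp (X u) α (l + 1)) (hDT.nonzero u hu α)
      (D := fun j i => dTheta X u j α i α) hN h0 h1 hv fun i j k hi hj hk => ?_)
    (fun j h hj => dTheta_left_out _ _ _ _ _ _ (by omega))
    (fun j h hj => dTheta_right_out _ _ _ _ _ _ (by omega)) (fun n hn => comp_of_gt _ hn)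
  have e := hDT.chr_eq hu i α j α k α hi hj hk
  rwa [if_pos rfl, if_pos rfl] at e

/-- Low symbols vanish for `s < j`, and the one-form leaves its block for `s > m α + 1 - i`. The
remaining interval is empty exactly in the range of the zero equations. -/
theorem crossSystem_iff (hm : ∀ α, 1 ≤ m α) (hU : IsOpen U) (hDT : IsDarbouxTsarev U X Γ)
    (hu : u ∈ U) (θ : Pt m → Idx m → ℝ) :
    CrossSystem Γ θ u ↔
    (∀ α β : Fin r, α ≠ β → ∀ i j, 1 ≤ i → i ≤ m α → 1 ≤ j → j ≤ m β → m α + 2 ≤ i + j →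
      dTheta θ u j β i α = 0) ∧
    (∀ α β : Fin r, α ≠ β → ∀ i j, 1 ≤ i → i ≤ m α → 1 ≤ j → j ≤ m β → i + j ≤ m α + 1 →
      dTheta θ u j β i α
        = 2 * ∑ s ∈ Finset.Icc j (m α + 1 - i),
          chr Γ u s α j β 1 α * comp (θ u) α (s + i - 1)) := by
  have key : ∀ α β : Fin r, α ≠ β → ∀ i j, 1 ≤ i → 1 ≤ j →
      ∑ s ∈ Finset.range (m α + 1), chr Γ u s α j β 1 α * comp (θ u) α (i + s - 1)
      = ∑ s ∈ Finset.Icc j (m α + 1 - i), chr Γ u s α j β 1 α * comp (θ u) α (s + i - 1) := by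
    intro α β hαβ i j hi hj
    simp only [add_comm _ i]
    refine (Finset.sum_subset (fun s hs => ?_) fun s _ hs => ?_).symm
    · have := Finset.mem_Icc.1 hs
      exact Finset.mem_range.2 (by omega)
    · rw [Finset.mem_Icc] at hs
      rcases Nat.lt_or_ge s j with hsj | hsj
      · rw [hDT.chr_mixed_low hm hU hu hαβ s j hj hsj, zero_mul]
      · rw [comp_of_gt _ (by omega), mul_zero]
  constructor
  · refine fun hC => ⟨fun α β hαβ i j hi hi' hj hj' h => ?_,
      fun α β hαβ i j hi hi' hj hj' h => ?_⟩
    · rw [hC α β hαβ i j hi hi' hj hj', key α β hαβ i j hi hj, Finset.Icc_eq_empty (by omega),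
        Finset.sum_empty, mul_zero]
    · rw [hC α β hαβ i j hi hi' hj hj', key α β hαβ i j hi hj]
  · rintro ⟨hz, hd⟩ α β hαβ i j hi hi' hj hj'
    rw [key α β hαβ i j hi hj]
    rcases Nat.lt_or_ge (m α + 1) (i + j) with h | h
    · rw [hz α β hαβ i j hi hi' hj hj' h, Finset.Icc_eq_empty (by omega), Finset.sum_empty,
        mul_zero]
    · exact hd α β hαβ i j hi hi' hj hj' h

end Connection

end DarbouxTsarev

theorem mainTheorem4 {r : ℕ} {m : Fin r → ℕ} (hm : ∀ α, 1 ≤ m α)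
    (U : Set (DarbouxTsarev.Pt m)) (hU : IsOpen U)
    (X : DarbouxTsarev.Pt m → DarbouxTsarev.Idx m → ℝ)
    (Γ : DarbouxTsarev.Pt m → DarbouxTsarev.Idx m → DarbouxTsarev.Idx m →
      DarbouxTsarev.Idx m → ℝ)
    (hDT : DarbouxTsarev.IsDarbouxTsarev U X Γ)
    (θ : DarbouxTsarev.Pt m → DarbouxTsarev.Idx m → ℝ)
    (hθ : ∀ a, DifferentiableOn ℝ (fun u => θ u a) U) :
    DarbouxTsarev.MetricSystem U Γ θ ↔ DarbouxTsarev.ExplicitSystem U Γ θ := by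
  rw [DarbouxTsarev.metricSystem_iff hm hDT]
  constructor
  · intro H
    have hC := fun u hu => (DarbouxTsarev.crossSystem_iff hm hU hDT hu θ).1 (H u hu).1
    have hB := fun u hu α => (DarbouxTsarev.blockSystem_iff hm hU hDT hu θ α).1 ((H u hu).2 α)
    refine ⟨fun u hu α β i j hi hi' hj hj' h => ?_, fun u hu α => (hB u hu α).2.1,
      fun u hu α => (hB u hu α).2.2, fun u hu => (hC u hu).2⟩
    by_cases hβα : β = α
    · subst hβα
      rw [if_pos rfl] at h
      exact (hB u hu β).1 i j hi hi' hj hj' h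
    · rw [if_neg hβα] at h
      exact (hC u hu).1 α β (Ne.symm hβα) i j hi hi' hj hj' h
  · intro H u hu
    refine ⟨(DarbouxTsarev.crossSystem_iff hm hU hDT hu θ).2
        ⟨fun α β hαβ i j hi hi' hj hj' h => ?_, H.diffBlock u hu⟩,
      fun α => (DarbouxTsarev.blockSystem_iff hm hU hDT hu θ α).2
        ⟨fun i j hi hi' hj hj' h => ?_, H.top u hu α, H.sameBlock u hu α⟩⟩
    · exact H.zeros u hu α β i j hi hi' hj hj' (by rwa [if_neg hαβ.symm])
    · exact H.zeros u hu α α i j hi hi' hj hj' (by rwa [if_pos rfl])
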